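/- **Setting.** Let $p,n\in\mathbb N$, $j=\operatorname{diag}(I_p,-I_p)$, and write $\mathbb C_M=\{z\in\mathbb C:\operatorname{Im} z>M\}$. For a $p\times p$ matrix function $\widetilde v$ on $[0,\infty)$ consider the skew-self-adjoint Dirac system $$y'(x,z)=\big(\mathrm i zj+j\widetilde V(x)\big)y(x,z),\quad x\ge 0,\qquad \widetilde V=\begin{bmatrix}0&\widetilde v\\ \widetilde v^*&0\end{bmatrix},\tag{1}$$ with fundamental solution $W(x,z)$ normalised by $W(0,z)=I_{2p}$. A $p\times p$ matrix function $\varphi$ which, for some $M>0$, is holomorphic in $\mathbb C_M$ is called * a *Weyl function* of (1) (on $\mathbb C_M$) if $\int_0^\infty\begin{bmatrix}I_p&\varphi(z)^*\end{bmatrix}W(x,z)^*W(x,z)\begin{bmatrix}I_p\\ \varphi(z)\end{bmatrix}dx<\infty$ for all $z\in\mathbb C_M$; * a *generalised Weyl function* (GW-function) of (1) (on $\mathbb C_M$), where $\widetilde v$ is locally bounded on $[0,\infty)$, if $\sup_{0\le x\le \ell,\ z\in\mathbb C_M}\Big\|\mathrm e^{-\mathrm izx}W(x,z)\begin{bmatrix}I_p\\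 \varphi(z)\end{bmatrix}\Big\|<\infty$ for every $\ell<\infty$. Let $a\in\mathbb C\setminus\{0\}$, $c\in\mathbb R$, and let $A\in\mathbb C^{n\times n}$ satisfy $\det\big((A-cI_n)^2+|a|^2I_n\big)\neq0$. Choose $Q\in\mathbb C^{n\times n}$ with $AQ=QA$ and $Q^2=(A-cI_n)^2+|a|^2I_n$. Let $f_1,f_2\in\mathbb C^{n\times p}$, $f_3=\frac{\mathrm i}{\overline a}(Q+A-cI_n)f_1$, $f_4=-\frac{\mathrm i}{\overline a}(Q-A+cI_n)f_2$, and for $x\ge0$ put $$\Lambda_1(x)=\mathrm e^{-\mathrm icx}\big(\mathrm e^{\mathrm ixQ}f_1+\mathrm e^{-\mathrm ixQ}f_2\big),\quad \Lambda_2(x)=\mathrm e^{\mathrm icx}\big(\mathrm e^{\mathrm ixQ}f_3+\mathrm e^{-\mathrm ixQ}f_4\big),\quad \Pi(x)=\begin{bmatrix}\Lambda_1(x)&\Lambda_2(x)\end{bmatrix}.$$ Let $S(0)>0$ satisfy $AS(0)-S(0)A^*=\mathrm i\,\Pi(0)\Pi(0)^*$, and put $S(x)=S(0)+\int_0^x\Pi(r)j\Pi(r)^*dr$.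 The transformed system is (1) with $$\widetilde v(x)=a\,\mathrm e^{2\mathrm icx}I_p+2\Lambda_1(x)^*S(x)^{-1}\Lambda_2(x).$$ Let $\zeta(z)=\sqrt{(z-c)^2+|a|^2}$ be the branch with $\operatorname{Im}\zeta(z)>0$ on the cut upper half-plane $\Omega=\{z:\operatorname{Im} z>0\}\setminus\{c+\mathrm it:0<t\le|a|\}$, and for $z\in\Omega$ put $$h(z)=z-c-\zeta(z),\quad \mathcal D=h(z)I_p,\quad \mathcal B=\mathrm ia\Lambda_1(0)+h(z)\Lambda_2(0),$$ $$\mathcal C_1=\tfrac1a\Lambda_1(0)^*S(0)^{-1},\quad \mathcal C_2=\mathrm i\Lambda_2(0)^*S(0)^{-1},\quad \mathcal A^\times=A-\mathcal B\,\mathcal C_1 .$$ **Theorem.** The Weyl function of the transformed system, which is also its GW-function, is $$\varphi(z)=\frac1{\mathrm ia}\Big(\mathcal D+(\mathcal D\mathcal C_1-\mathcal C_2)(\mathcal A^\times-zI_n)^{-1}\mathcal B\Big).\tag{2}$$ That is: (i) there is an $M\ge|a|$ such that $\mathcal A^\times-zI_n$ is invertible for all $z\in\mathbb C_M$, and the function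 $\varphi$ given by (2) is both a Weyl function and a GW-function of the transformed system on $\mathbb C_M$; (ii) for every $M>0$, every Weyl function and every GW-function of the transformed system on $\mathbb C_M$ is equal to the right-hand side of (2) at each $z\in\mathbb C_M\cap\Omega$ at which $\mathcal A^\times-zI_n$ is invertible. -/

import Mathlib

open Matrix MeasureTheory
open scoped ComplexOrder

noncomputable section

namespace SkewDirac

/-- The signature matrix `j = diag(I_p, -I_p)`. -/
def jMat (p : ℕ) : Matrix (Fin p ⊕ Fin p) (Fin p ⊕ Fin p) ℂ :=
  Matrix.fromBlocks 1 0 0 (-1)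

/-- The Hermitian off-diagonal potential `[[0, v], [v*, 0]]`. -/
def potential {p : ℕ} (v : Matrix (Fin p) (Fin p) ℂ) :
    Matrix (Fin p ⊕ Fin p) (Fin p ⊕ Fin p) ℂ :=
  Matrix.fromBlocks 0 v vᴴ 0

/-- The open half-plane `{z : Im z > M}`. -/
def halfPlane (M : ℝ) : Set ℂ := {z | M < z.im}

/-- `W(x, z)` (`x ≥ 0`, `z ∈ U`) is the fundamental solution, normalised by `W(0, z) = I_{2p}`, of
the skew-self-adjoint Dirac system `y' = (i z j + j V(x)) y` on `[0, ∞)`, where `V` is built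
from `v`. Derivatives are taken entrywise and are one-sided at `x = 0`. -/
def IsNormalizedFundamentalSolution {p : ℕ} (v : ℝ → Matrix (Fin p) (Fin p) ℂ) (U : Set ℂ)
    (W : ℝ → ℂ → Matrix (Fin p ⊕ Fin p) (Fin p ⊕ Fin p) ℂ) : Prop :=
  ∀ z ∈ U, W 0 z = 1 ∧
    ∀ x : ℝ, 0 ≤ x → ∀ i k, HasDerivWithinAt (fun t : ℝ => W t z i k)
      ((((Complex.I * z) • jMat p + jMat p * potential (v x)) * W x z) i k) (Set.Ici 0) x

/-- The `2p × p` matrix function `W(x, z) [I_p; φ(z)]`. -/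
def weylSolution {p : ℕ} (W : ℝ → ℂ → Matrix (Fin p ⊕ Fin p) (Fin p ⊕ Fin p) ℂ)
    (φ : ℂ → Matrix (Fin p) (Fin p) ℂ) (x : ℝ) (z : ℂ) : Matrix (Fin p ⊕ Fin p) (Fin p) ℂ :=
  W x z * Matrix.fromRows (1 : Matrix (Fin p) (Fin p) ℂ) (φ z)

/-- Entrywise holomorphy of a matrix function on a set. -/
def HolomorphicOn {p : ℕ} (φ : ℂ → Matrix (Fin p) (Fin p) ℂ) (U : Set ℂ) : Prop :=
  ∀ i k, DifferentiableOn ℂ (fun z => φ z i k) U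

/-- `φ` is a Weyl function, on the half-plane `Im z > M`, of the skew-self-adjoint Dirac system
on `[0, ∞)` with potential built from `v`: it is holomorphic there and
`∫₀^∞ [I_p φ(z)*] W(x, z)* W(x, z) [I_p; φ(z)] dx < ∞`. The integrand below is a positive semidefinite matrix
function, so finiteness of its integral is integrability of all its entries. -/
def IsWeylFunction {p : ℕ} (v : ℝ → Matrix (Fin p) (Fin p) ℂ) (M : ℝ)
    (φ : ℂ → Matrix (Fin p) (Fin p) ℂ) : Prop :=
  0 < M ∧ HolomorphicOn φ (halfPlane M) ∧
    ∃ W : ℝ → ℂ → Matrix (Fin p ⊕ Fin p) (Fin p ⊕ Fin p) ℂ,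
      IsNormalizedFundamentalSolution v (halfPlane M) W ∧
      ∀ z ∈ halfPlane M, ∀ i k, IntegrableOn
        (fun x : ℝ => ((weylSolution W φ x z)ᴴ * weylSolution W φ x z) i k)
        (Set.Ioi 0)

/-- Local boundedness on `[0, ∞)`, entrywise. -/
def LocallyBoundedOnHalfLine {p : ℕ} (v : ℝ → Matrix (Fin p) (Fin p) ℂ) : Prop :=
  ∀ l : ℝ, ∃ K : ℝ, ∀ x ∈ Set.Icc 0 l, ∀ i k, ‖v x i k‖ ≤ K

/-- `φ` is a generalised Weyl function (GW-function), on the half-plane `Im z > M`, of the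
skew-self-adjoint Dirac system on `[0, ∞)` with locally bounded potential built from `v`.
The finiteness of the supremum of the norm is expressed by a common bound for all entries. -/
def IsGWFunction {p : ℕ} (v : ℝ → Matrix (Fin p) (Fin p) ℂ) (M : ℝ)
    (φ : ℂ → Matrix (Fin p) (Fin p) ℂ) : Prop :=
  0 < M ∧ LocallyBoundedOnHalfLine v ∧ HolomorphicOn φ (halfPlane M) ∧
    ∃ W : ℝ → ℂ → Matrix (Fin p ⊕ Fin p) (Fin p ⊕ Fin p) ℂ,
      IsNormalizedFundamentalSolution v (halfPlane M) W ∧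
      ∀ l : ℝ, ∃ K : ℝ, ∀ x ∈ Set.Icc 0 l, ∀ z ∈ halfPlane M, ∀ i k,
        ‖(Complex.exp (-(Complex.I * z * x)) • weylSolution W φ x z) i k‖ ≤ K

/-- The initial potential `v(x) = a e^{2icx} I_p`. -/
def initialPotential (p : ℕ) (a : ℂ) (c : ℝ) (x : ℝ) : Matrix (Fin p) (Fin p) ℂ :=
  (a * Complex.exp (2 * Complex.I * c * x)) • 1

/-- `f₃ = (i / ā) (Q + A - c I) f₁`. -/
def f3 {n p : ℕ} (a : ℂ) (c : ℝ) (A Q : Matrix (Fin n) (Fin n) ℂ)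
    (f1 : Matrix (Fin n) (Fin p) ℂ) : Matrix (Fin n) (Fin p) ℂ :=
  (Complex.I / star a) • ((Q + A - (c : ℂ) • 1) * f1)

/-- `f₄ = -(i / ā) (Q - A + c I) f₂`. -/
def f4 {n p : ℕ} (a : ℂ) (c : ℝ) (A Q : Matrix (Fin n) (Fin n) ℂ)
    (f2 : Matrix (Fin n) (Fin p) ℂ) : Matrix (Fin n) (Fin p) ℂ :=
  (-(Complex.I / star a)) • ((Q - A + (c : ℂ) • 1) * f2)

/-- `e^{ixQ}`. -/
def expI {n : ℕ} (Q : Matrix (Fin n) (Fin n) ℂ) (x : ℝ) : Matrix (Fin n) (Fin n) ℂ :=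
  NormedSpace.exp ((Complex.I * x) • Q)

/-- `Λ₁(x) = e^{-icx} (e^{ixQ} f₁ + e^{-ixQ} f₂)`. -/
def Lam1 {n p : ℕ} (c : ℝ) (Q : Matrix (Fin n) (Fin n) ℂ)
    (f1 f2 : Matrix (Fin n) (Fin p) ℂ) (x : ℝ) : Matrix (Fin n) (Fin p) ℂ :=
  Complex.exp (-(Complex.I * c * x)) • (expI Q x * f1 + expI Q (-x) * f2)

/-- `Λ₂(x) = e^{icx} (e^{ixQ} f₃ + e^{-ixQ} f₄)`. -/
def Lam2 {n p : ℕ} (a : ℂ) (c : ℝ) (A Q : Matrix (Fin n) (Fin n) ℂ)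
    (f1 f2 : Matrix (Fin n) (Fin p) ℂ) (x : ℝ) : Matrix (Fin n) (Fin p) ℂ :=
  Complex.exp (Complex.I * c * x) •
    (expI Q x * f3 a c A Q f1 + expI Q (-x) * f4 a c A Q f2)

/-- `Π(x) = [Λ₁(x) Λ₂(x)]`. -/
def PiMat {n p : ℕ} (a : ℂ) (c : ℝ) (A Q : Matrix (Fin n) (Fin n) ℂ)
    (f1 f2 : Matrix (Fin n) (Fin p) ℂ) (x : ℝ) : Matrix (Fin n) (Fin p ⊕ Fin p) ℂ :=
  Matrix.fromCols (Lam1 c Q f1 f2 x) (Lam2 a c A Q f1 f2 x)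

/-- `S(x) = S(0) + ∫₀ˣ Π(r) j Π(r)* dr`, the integral being taken entrywise. -/
def SMat {n p : ℕ} (a : ℂ) (c : ℝ) (A Q S0 : Matrix (Fin n) (Fin n) ℂ)
    (f1 f2 : Matrix (Fin n) (Fin p) ℂ) (x : ℝ) : Matrix (Fin n) (Fin n) ℂ :=
  Matrix.of fun i k => S0 i k +
    ∫ r in (0 : ℝ)..x, (PiMat a c A Q f1 f2 r * jMat p * (PiMat a c A Q f1 f2 r)ᴴ) i k

/-- The transformed potential `ṽ(x) = v(x) + 2 Λ₁(x)* S(x)⁻¹ Λ₂(x)`. -/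
def transformedPotential {n p : ℕ} (a : ℂ) (c : ℝ) (A Q S0 : Matrix (Fin n) (Fin n) ℂ)
    (f1 f2 : Matrix (Fin n) (Fin p) ℂ) (x : ℝ) : Matrix (Fin p) (Fin p) ℂ :=
  initialPotential p a c x + (2 : ℂ) •
    ((Lam1 c Q f1 f2 x)ᴴ * (SMat a c A Q S0 f1 f2 x)⁻¹ * Lam2 a c A Q f1 f2 x)

/-- `ζ` is the branch of `√((z - c)² + |a|²)` with values in the upper half-plane, on the upper
half-plane cut along the segment `(c, c + i|a|]` (on which both roots are real). -/
def IsUpperBranch (a : ℂ) (c : ℝ) (ζ : ℂ → ℂ) : Prop :=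
  ∀ z : ℂ, 0 < z.im → ¬ (z.re = c ∧ z.im ≤ ‖a‖) →
    ζ z ^ 2 = (z - c) ^ 2 + (‖a‖ : ℂ) ^ 2 ∧ 0 < (ζ z).im

/-- `h(z) = z - c - ζ(z)`. -/
def hFun (c : ℝ) (ζ : ℂ → ℂ) (z : ℂ) : ℂ := z - c - ζ z

/-- `D = h I_p`. -/
def DMat (p : ℕ) (h : ℂ) : Matrix (Fin p) (Fin p) ℂ := h • 1

/-- `B = i a Λ₁(0) + h Λ₂(0)`. -/
def BMat {n p : ℕ} (a h : ℂ) (L1 L2 : Matrix (Fin n) (Fin p) ℂ) : Matrix (Fin n) (Fin p) ℂ :=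
  (Complex.I * a) • L1 + h • L2

/-- `C₁ = a⁻¹ Λ₁(0)* S(0)⁻¹`. -/
def C1Mat {n p : ℕ} (a : ℂ) (S0 : Matrix (Fin n) (Fin n) ℂ) (L1 : Matrix (Fin n) (Fin p) ℂ) :
    Matrix (Fin p) (Fin n) ℂ :=
  (1 / a) • (L1ᴴ * S0⁻¹)

/-- `C₂ = i Λ₂(0)* S(0)⁻¹`. -/
def C2Mat {n p : ℕ} (S0 : Matrix (Fin n) (Fin n) ℂ) (L2 : Matrix (Fin n) (Fin p) ℂ) :
    Matrix (Fin p) (Fin n) ℂ :=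
  Complex.I • (L2ᴴ * S0⁻¹)

/-- `A^× = A - B C₁`. -/
def ACross {n p : ℕ} (a h : ℂ) (A S0 : Matrix (Fin n) (Fin n) ℂ)
    (L1 L2 : Matrix (Fin n) (Fin p) ℂ) : Matrix (Fin n) (Fin n) ℂ :=
  A - BMat a h L1 L2 * C1Mat a S0 L1

/-- `A^× - z I_n`, with `h = h(z)`. -/
def pencil {n p : ℕ} (a : ℂ) (c : ℝ) (ζ : ℂ → ℂ) (A S0 : Matrix (Fin n) (Fin n) ℂ)
    (L1 L2 : Matrix (Fin n) (Fin p) ℂ) (z : ℂ) : Matrix (Fin n) (Fin n) ℂ :=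
  ACross a (hFun c ζ z) A S0 L1 L2 - z • 1

/-- `φ(z) = (1 / (i a)) (D + (D C₁ - C₂) (A^× - z I_n)⁻¹ B)`. -/
def weylFormula {n p : ℕ} (a : ℂ) (c : ℝ) (ζ : ℂ → ℂ) (A S0 : Matrix (Fin n) (Fin n) ℂ)
    (L1 L2 : Matrix (Fin n) (Fin p) ℂ) (z : ℂ) : Matrix (Fin p) (Fin p) ℂ :=
  (1 / (Complex.I * a)) • (DMat p (hFun c ζ z) +
    (DMat p (hFun c ζ z) * C1Mat a S0 L1 - C2Mat S0 L2) *
      (pencil a c ζ A S0 L1 L2 z)⁻¹ * BMat a (hFun c ζ z) L1 L2)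

end SkewDirac

end

noncomputable section

namespace SkewDirac

/-! The transformed system is a Darboux transform of the explicitly solvable system with potential
`a e^{2icx} I`. Write `w(x, z) = I - i Π* S⁻¹ (A - z)⁻¹ Π`. The identity `A S - S A* = i Π Π*`
persists in `x`, `S` stays positive definite, and `w` carries solutions of the initial system to
solutions of the transformed one (`deriv_darbouxMat_mul`).

Uniformity in `x` comes from the constant trace `tr Π* S⁻¹ Π = 2 Im tr A` (`trace_gramMat`). It
bounds the transformed potential and, with the Gram identity for `w* w`, gives `‖w U‖ ≤ 3 ‖U‖` once
`Im z ≥ 2 Im tr A`.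

Existence: the initial system has a solution of size `e^{-x Im ζ}` starting at `[I; h/(ia)]`.
Applying `w(0, z)` and normalising the upper block to `I` turns this initial value into `[I; φ]`,
where `φ` is the stated formula (`darbouxMat_mul_weyl`). So the solution for `φ` is also `O(e^{-x Im
ζ})`, which gives the Weyl property. The GW property follows from `Im z - Im ζ = Im h ≤ |a|`.

Uniqueness: the solutions of two candidates differ by a solution starting at `[0; ψ₁ - ψ₂]`, whose
norm never drops below `‖ψ₁ - ψ₂‖` for large `Im z` (`norm_le_norm_of_hasMatDeriv`). Square
integrability then forces equality. In the GW case the difference is `O(e^{-l Im z})` for every `l`,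
and Phragmén–Lindelöf makes it zero. The identity theorem on the connected cut half-plane carries
the equality down (`eq_weylFormula_of_eqOn`). -/

open scoped MatrixOrder in
theorem exists_eq_conjTranspose_mul_self {m : Type*} [Fintype m] [DecidableEq m]
    {M : Matrix m m ℂ} (hM : M.PosSemidef) : ∃ B : Matrix m m ℂ, M = Bᴴ * B :=
  CStarAlgebra.nonneg_iff_eq_star_mul_self.mp hM.nonneg

-- Entrywise calculus of matrix functions of a real variable.

attribute [local instance] Matrix.frobeniusNormedAddCommGroup Matrix.frobeniusNormedSpace
  Matrix.frobeniusNormedRing Matrix.frobeniusNormedAlgebra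

/-- Entrywise differentiability of a matrix function of a real variable within a set. -/
def HasMatDeriv {m k : Type*} (F : ℝ → Matrix m k ℂ) (F' : Matrix m k ℂ) (s : Set ℝ) (x : ℝ) :
    Prop :=
  ∀ i j, HasDerivWithinAt (fun t => F t i j) (F' i j) s x

namespace HasMatDeriv

variable {m k l : Type*} {s : Set ℝ} {x : ℝ}

theorem const (F : Matrix m k ℂ) : HasMatDeriv (fun _ => F) 0 s x :=
  fun i j => hasDerivWithinAt_const x s (F i j)

theorem add {F G : ℝ → Matrix m k ℂ} {F' G' : Matrix m k ℂ} (hF : HasMatDeriv F F' s x)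
    (hG : HasMatDeriv G G' s x) : HasMatDeriv (fun t => F t + G t) (F' + G') s x :=
  fun i j => (hF i j).add (hG i j)

theorem sub {F G : ℝ → Matrix m k ℂ} {F' G' : Matrix m k ℂ} (hF : HasMatDeriv F F' s x)
    (hG : HasMatDeriv G G' s x) : HasMatDeriv (fun t => F t - G t) (F' - G') s x :=
  fun i j => (hF i j).sub (hG i j)

theorem mul [Fintype k] {F : ℝ → Matrix m k ℂ} {G : ℝ → Matrix k l ℂ} {F' : Matrix m k ℂ}
    {G' : Matrix k l ℂ} (hF : HasMatDeriv F F' s x) (hG : HasMatDeriv G G' s x) :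
    HasMatDeriv (fun t => F t * G t) (F' * G x + F x * G') s x := by
  intro i j
  simp only [Matrix.mul_apply, Matrix.add_apply, ← Finset.sum_add_distrib]
  exact HasDerivWithinAt.fun_sum fun r _ => (hF i r).mul (hG r j)

theorem smul {f : ℝ → ℂ} {f' : ℂ} {F : ℝ → Matrix m k ℂ} {F' : Matrix m k ℂ}
    (hf : HasDerivWithinAt f f' s x) (hF : HasMatDeriv F F' s x) :
    HasMatDeriv (fun t => f t • F t) (f' • F x + f x • F') s x :=
  fun i j => hf.mul (hF i j)

theorem conjTranspose {F : ℝ → Matrix m k ℂ} {F' : Matrix m k ℂ} (hF : HasMatDeriv F F' s x) :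
    HasMatDeriv (fun t => (F t)ᴴ) F'ᴴ s x :=
  fun i j => (hF j i).star

theorem fromCols {F : ℝ → Matrix m k ℂ} {G : ℝ → Matrix m l ℂ} {F' : Matrix m k ℂ}
    {G' : Matrix m l ℂ} (hF : HasMatDeriv F F' s x) (hG : HasMatDeriv G G' s x) :
    HasMatDeriv (fun t => Matrix.fromCols (F t) (G t)) (Matrix.fromCols F' G') s x := by
  rintro i (j | j)
  · exact hF i j
  · exact hG i j

theorem congr_deriv {F : ℝ → Matrix m k ℂ} {F' G' : Matrix m k ℂ} (hF : HasMatDeriv F F' s x)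
    (h : F' = G') : HasMatDeriv F G' s x := h ▸ hF

theorem of_hasDerivAt [Fintype m] [Fintype k] {F : ℝ → Matrix m k ℂ} {F' : Matrix m k ℂ}
    (hF : HasDerivAt F F' x) : HasMatDeriv F F' s x := by
  intro i j
  have h := ((Matrix.entryLinearMap ℝ ℂ i j).toContinuousLinearMap.hasFDerivAt
    (x := F x)).comp_hasDerivAt x hF
  exact h.hasDerivWithinAt

theorem hasDerivWithinAt [Fintype m] [Fintype k] [DecidableEq m] [DecidableEq k]
    {F : ℝ → Matrix m k ℂ} {F' : Matrix m k ℂ}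
    (hF : HasMatDeriv F F' s x) : HasDerivWithinAt F F' s x := by
  have h : HasDerivWithinAt (fun t => ∑ i, ∑ j, F t i j • Matrix.single i j (1 : ℂ))
      (∑ i, ∑ j, F' i j • Matrix.single i j (1 : ℂ)) s x :=
    HasDerivWithinAt.fun_sum fun i _ => HasDerivWithinAt.fun_sum fun j _ =>
      (hF i j).smul_const _
  have e : ∀ M : Matrix m k ℂ, ∑ i, ∑ j, M i j • Matrix.single i j (1 : ℂ) = M := by
    intro M
    conv_rhs => rw [Matrix.matrix_eq_sum_single M]
    simp [Matrix.smul_single]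
  simpa only [e] using h

/-- The derivative of the inverse matrix function. -/
theorem inv [Fintype m] [DecidableEq m] {F : ℝ → Matrix m m ℂ} {F' : Matrix m m ℂ}
    (hF : HasMatDeriv F F' s x) (hu : IsUnit (F x)) :
    HasMatDeriv (fun t => (F t)⁻¹) (-((F x)⁻¹ * F' * (F x)⁻¹)) s x := by
  have h1 := hF.hasDerivWithinAt
  obtain ⟨u, hu⟩ := hu
  have h2 : HasFDerivAt (Ring.inverse : Matrix m m ℂ → Matrix m m ℂ) _ (F x) :=
    hu ▸ (hasFDerivAt_ringInverse (𝕜 := ℝ) u)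
  have h3 := h2.comp_hasDerivWithinAt x h1
  have e : (Ring.inverse ∘ F) = fun t => (F t)⁻¹ := by
    funext t; simp [Matrix.nonsing_inv_eq_ringInverse]
  rw [e] at h3
  intro i j
  have h4 := ((Matrix.entryLinearMap ℝ ℂ i j).toContinuousLinearMap.hasFDerivAt
    (x := (F x)⁻¹)).comp_hasDerivWithinAt x h3
  refine h4.congr_deriv ?_
  have : ((u⁻¹ : (Matrix m m ℂ)ˣ) : Matrix m m ℂ) = (F x)⁻¹ := by
    rw [Matrix.coe_units_inv, hu]
  simp only [this, _root_.neg_apply, ContinuousLinearMap.mulLeftRight_apply]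
  rfl

end HasMatDeriv

theorem hasMatDeriv_expI {n : ℕ} (Q : Matrix (Fin n) (Fin n) ℂ) (s : Set ℝ) (x : ℝ) :
    HasMatDeriv (fun t => expI Q t) ((Complex.I • Q) * expI Q x) s x := by
  have h := hasDerivAt_exp_smul_const' (𝕂 := ℝ) (Complex.I • Q) x
  have e : ∀ t : ℝ, t • (Complex.I • Q) = (Complex.I * t) • Q := by
    intro t
    rw [← Complex.coe_smul, smul_smul, mul_comm]
  simp only [e] at h
  exact HasMatDeriv.of_hasDerivAt h

theorem hasMatDeriv_expI_neg {n : ℕ} (Q : Matrix (Fin n) (Fin n) ℂ) (s : Set ℝ) (x : ℝ) :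
    HasMatDeriv (fun t => expI Q (-t)) (-((Complex.I • Q) * expI Q (-x))) s x := by
  have h := hasMatDeriv_expI (-Q) s x
  have e : ∀ t : ℝ, expI (-Q) t = expI Q (-t) := by
    intro t; simp [expI]
  simp only [e] at h
  refine h.congr_deriv (by simp)

theorem expI_mul_expI_neg {n : ℕ} (Q : Matrix (Fin n) (Fin n) ℂ) (x : ℝ) :
    expI Q x * expI Q (-x) = 1 := by
  have : (Complex.I * ((-x : ℝ) : ℂ)) • Q = -((Complex.I * x) • Q) := by simp
  rw [expI, expI, this, Matrix.exp_neg]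
  exact Matrix.mul_nonsing_inv _ ((Matrix.isUnit_iff_isUnit_det _).mp (Matrix.isUnit_exp _))

theorem commute_expI {n : ℕ} {A Q : Matrix (Fin n) (Fin n) ℂ} (h : Commute A Q) (x : ℝ) :
    Commute A (expI Q x) :=
  (h.smul_right _).exp_right

theorem expI_zero {n : ℕ} (Q : Matrix (Fin n) (Fin n) ℂ) : expI Q 0 = 1 := by
  simp [expI]

/-! ### Algebra of the Darboux transformation. -/

variable {n p : ℕ}

theorem jMat_mul_self (p : ℕ) : jMat p * jMat p = 1 := by
  simp [jMat, Matrix.fromBlocks_multiply]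

theorem jMat_conjTranspose (p : ℕ) : (jMat p)ᴴ = jMat p := by
  simp [jMat, Matrix.fromBlocks_conjTranspose]

theorem potential_conjTranspose (v : Matrix (Fin p) (Fin p) ℂ) :
    (potential v)ᴴ = potential v := by
  simp [potential, Matrix.fromBlocks_conjTranspose]

theorem potential_mul_jMat (v : Matrix (Fin p) (Fin p) ℂ) :
    potential v * jMat p = -(jMat p * potential v) := by
  simp [potential, jMat, Matrix.fromBlocks_multiply, Matrix.fromBlocks_neg]

/-- The coefficient `i z j + j V` of the system. -/
def systemMat (v : Matrix (Fin p) (Fin p) ℂ) (z : ℂ) : Matrix (Fin p ⊕ Fin p) (Fin p ⊕ Fin p) ℂ :=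
  (Complex.I * z) • jMat p + jMat p * potential v

theorem eq_of_hasMatDeriv_zero {m k : Type*} {F : ℝ → Matrix m k ℂ}
    (h : ∀ x, 0 ≤ x → HasMatDeriv F 0 (Set.Ici 0) x) {x : ℝ} (hx : 0 ≤ x) : F x = F 0 := by
  ext i j
  refine constant_of_has_deriv_right_zero (f := fun t => F t i j) (a := 0) (b := x)
    (fun t ht => ((h t ht.1 i j).continuousWithinAt).mono Set.Icc_subset_Ici_self)
    (fun t ht => (h t ht.1 i j).mono (Set.Ici_subset_Ici.mpr ht.1)) x ⟨hx, le_rfl⟩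

/-- A Hermitian matrix function with positive semidefinite derivative is increasing. -/
theorem posSemidef_sub_of_hasMatDeriv {m : Type*} [Fintype m] {F F' : ℝ → Matrix m m ℂ}
    (h : ∀ x, 0 ≤ x → HasMatDeriv F (F' x) (Set.Ici 0) x)
    (hF' : ∀ x, 0 ≤ x → (F' x).PosSemidef) (hF : ∀ x, 0 ≤ x → (F x)ᴴ = F x)
    {x : ℝ} (hx : 0 ≤ x) : (F x - F 0).PosSemidef := by
  have hH : (F x - F 0).IsHermitian := by
    rw [Matrix.IsHermitian, Matrix.conjTranspose_sub, hF x hx, hF 0 le_rfl]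
  refine Matrix.PosSemidef.of_dotProduct_mulVec_nonneg hH fun q => ?_
  have hd : ∀ t, 0 ≤ t → HasDerivWithinAt (fun t => star q ⬝ᵥ (F t *ᵥ q))
      (star q ⬝ᵥ (F' t *ᵥ q)) (Set.Ici 0) t := by
    intro t ht
    simp only [dotProduct, Matrix.mulVec]
    exact HasDerivWithinAt.fun_sum fun i _ => (HasDerivWithinAt.fun_sum fun j _ =>
      (h t ht i j).mul_const (q j)).const_mul _
  have hre : ∀ t, 0 ≤ t → HasDerivWithinAt (fun t => (star q ⬝ᵥ (F t *ᵥ q)).re)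
      (star q ⬝ᵥ (F' t *ᵥ q)).re (Set.Ici 0) t := fun t ht =>
    Complex.reCLM.hasFDerivAt.comp_hasDerivWithinAt t (hd t ht)
  have hmono : MonotoneOn (fun t => (star q ⬝ᵥ (F t *ᵥ q)).re) (Set.Ici 0) := by
    refine monotoneOn_of_hasDerivWithinAt_nonneg (convex_Ici 0)
      (f' := fun t => (star q ⬝ᵥ (F' t *ᵥ q)).re)
      (fun t ht => (hre t ht).continuousWithinAt)
      (fun t ht => (hre t (interior_subset ht)).mono interior_subset)
      (fun t ht => (Complex.nonneg_iff.mp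
        ((hF' t (interior_subset ht)).dotProduct_mulVec_nonneg q)).1)
  have h1 := hmono (Set.mem_Ici.mpr le_rfl) hx hx
  rw [Complex.nonneg_iff]
  refine ⟨?_, ?_⟩
  · simp only [Matrix.sub_mulVec, dotProduct_sub, Complex.sub_re, sub_nonneg]
    exact h1
  · exact (hH.im_star_dotProduct_mulVec_self q).symm

/-- The data of a generalised Bäcklund–Darboux transformation of the system with potential `v`. -/
structure IsDarbouxData (A : Matrix (Fin n) (Fin n) ℂ) (v : ℝ → Matrix (Fin p) (Fin p) ℂ)
    (P : ℝ → Matrix (Fin n) (Fin p ⊕ Fin p) ℂ) (S : ℝ → Matrix (Fin n) (Fin n) ℂ) : Prop where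
  deriv_P : ∀ x, 0 ≤ x → HasMatDeriv P
    (-(Complex.I • (A * P x * jMat p)) - P x * (jMat p * potential (v x))) (Set.Ici 0) x
  deriv_S : ∀ x, 0 ≤ x → HasMatDeriv S (P x * jMat p * (P x)ᴴ) (Set.Ici 0) x
  identity_zero : A * S 0 - S 0 * Aᴴ = Complex.I • (P 0 * (P 0)ᴴ)
  posDef_zero : (S 0).PosDef

/-- `Π* S⁻¹ Π`. -/
def gramMat (P : Matrix (Fin n) (Fin p ⊕ Fin p) ℂ) (S : Matrix (Fin n) (Fin n) ℂ) :
    Matrix (Fin p ⊕ Fin p) (Fin p ⊕ Fin p) ℂ :=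
  Pᴴ * S⁻¹ * P

/-- The potential of the transformed system. -/
def darbouxPotential (v : Matrix (Fin p) (Fin p) ℂ) (P : Matrix (Fin n) (Fin p ⊕ Fin p) ℂ)
    (S : Matrix (Fin n) (Fin n) ℂ) : Matrix (Fin p) (Fin p) ℂ :=
  v + (2 : ℂ) • (gramMat P S).toBlocks₁₂

/-- The Darboux matrix `I - i Π* S⁻¹ (A - z I)⁻¹ Π`. -/
def darbouxMat (A : Matrix (Fin n) (Fin n) ℂ) (P : Matrix (Fin n) (Fin p ⊕ Fin p) ℂ)
    (S : Matrix (Fin n) (Fin n) ℂ) (z : ℂ) : Matrix (Fin p ⊕ Fin p) (Fin p ⊕ Fin p) ℂ :=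
  1 - Complex.I • (Pᴴ * S⁻¹ * (A - z • 1)⁻¹ * P)

/-- The commutator of `j` with the Gram matrix kills the diagonal blocks and doubles the
off-diagonal ones up to sign, which is the origin of the factor `2` in the potential. Hermiticity of
`S` makes the two off-diagonal blocks adjoint to each other. -/
theorem jMat_mul_potential_darboux (v : Matrix (Fin p) (Fin p) ℂ)
    (P : Matrix (Fin n) (Fin p ⊕ Fin p) ℂ) {S : Matrix (Fin n) (Fin n) ℂ} (hS : Sᴴ = S) :
    jMat p * potential (darbouxPotential v P S) =
      jMat p * potential v + jMat p * gramMat P S - gramMat P S * jMat p := by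
  have hX : (gramMat P S)ᴴ = gramMat P S := by
    simp [gramMat, Matrix.conjTranspose_mul, Matrix.conjTranspose_nonsing_inv, hS,
      Matrix.mul_assoc]
  unfold darbouxPotential
  generalize gramMat P S = X at *
  obtain ⟨X11, X12, X21, X22, rfl⟩ : ∃ a b c d, X = Matrix.fromBlocks a b c d :=
    ⟨_, _, _, _, (Matrix.fromBlocks_toBlocks X).symm⟩
  rw [Matrix.fromBlocks_conjTranspose, Matrix.fromBlocks_inj] at hX
  obtain ⟨h1, h2, h3, h4⟩ := hX
  simp only [potential, jMat, Matrix.fromBlocks_multiply, Matrix.toBlocks_fromBlocks₁₂,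
    Matrix.fromBlocks_add, sub_eq_add_neg, Matrix.fromBlocks_neg, Matrix.fromBlocks_inj]
  refine ⟨?_, ?_, ?_, ?_⟩ <;>
    simp only [Matrix.one_mul, Matrix.mul_one, Matrix.zero_mul, Matrix.mul_zero, zero_add,
      add_zero, Matrix.neg_mul, Matrix.mul_neg, Matrix.conjTranspose_add,
      Matrix.conjTranspose_smul, h3, star_ofNat] <;> module

namespace IsDarbouxData

variable {A : Matrix (Fin n) (Fin n) ℂ} {v : ℝ → Matrix (Fin p) (Fin p) ℂ}
  {P : ℝ → Matrix (Fin n) (Fin p ⊕ Fin p) ℂ} {S : ℝ → Matrix (Fin n) (Fin n) ℂ}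

theorem deriv_P_conjTranspose (h : IsDarbouxData A v P S) {x : ℝ} (hx : 0 ≤ x) :
    HasMatDeriv (fun t => (P t)ᴴ) (Complex.I • (jMat p * (P x)ᴴ * Aᴴ) +
      jMat p * potential (v x) * (P x)ᴴ) (Set.Ici 0) x := by
  refine (h.deriv_P x hx).conjTranspose.congr_deriv ?_
  simp only [Matrix.conjTranspose_sub, Matrix.conjTranspose_neg, Matrix.conjTranspose_smul,
    Matrix.conjTranspose_mul, jMat_conjTranspose, potential_conjTranspose, potential_mul_jMat,
    Complex.star_def, Complex.conj_I, Matrix.mul_assoc, Matrix.neg_mul]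
  module

theorem identity (h : IsDarbouxData A v P S) {x : ℝ} (hx : 0 ≤ x) :
    A * S x - S x * Aᴴ = Complex.I • (P x * (P x)ᴴ) := by
  have key : ∀ t, 0 ≤ t → HasMatDeriv
      (fun t => A * S t - S t * Aᴴ - Complex.I • (P t * (P t)ᴴ)) 0 (Set.Ici 0) t := by
    intro t ht
    have hP := h.deriv_P t ht
    have hPc := h.deriv_P_conjTranspose ht
    have hS := h.deriv_S t ht
    refine ((((HasMatDeriv.const A).mul hS).sub (hS.mul (HasMatDeriv.const Aᴴ))).sub
      (HasMatDeriv.smul (hasDerivWithinAt_const t _ Complex.I) (hP.mul hPc))).congr_deriv ?_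
    simp only [Matrix.mul_add, Matrix.sub_mul, Matrix.mul_smul, Matrix.smul_mul,
      Matrix.neg_mul, Matrix.mul_assoc, smul_add, smul_sub, smul_neg, smul_smul,
      Complex.I_mul_I, Matrix.zero_mul, Matrix.mul_zero]
    module
  have := eq_of_hasMatDeriv_zero key hx
  simp only [h.identity_zero, sub_self] at this
  exact sub_eq_zero.mp this

theorem isHermitian (h : IsDarbouxData A v P S) {x : ℝ} (hx : 0 ≤ x) : (S x)ᴴ = S x := by
  have key : ∀ t, 0 ≤ t → HasMatDeriv (fun t => (S t)ᴴ - S t) 0 (Set.Ici 0) t := by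
    intro t ht
    refine ((h.deriv_S t ht).conjTranspose.sub (h.deriv_S t ht)).congr_deriv ?_
    simp [Matrix.conjTranspose_mul, jMat_conjTranspose, Matrix.mul_assoc]
  have := eq_of_hasMatDeriv_zero key hx
  have h0 : (S 0)ᴴ = S 0 := h.posDef_zero.1
  simp only [h0, sub_self] at this
  exact sub_eq_zero.mp this

/-- The derivative of `S` is indefinite, but conjugation by `e^{-ixA}` adds `Π Π*` through the
operator identity. The derivative then contains `1 + j ≥ 0` in place of `j`, so the conjugated `S`
increases from `S(0) > 0`. -/
theorem posDef (h : IsDarbouxData A v P S) {x : ℝ} (hx : 0 ≤ x) : (S x).PosDef := by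
  set G : ℝ → Matrix (Fin n) (Fin n) ℂ := fun t => expI A (-t) with hG
  have hGd : ∀ t, HasMatDeriv G (-((Complex.I • A) * G t)) (Set.Ici 0) t :=
    fun t => hasMatDeriv_expI_neg A _ t
  have hcomm : ∀ t, A * G t = G t * A := fun t => commute_expI (Commute.refl A) (-t)
  have hT : ∀ t, 0 ≤ t → HasMatDeriv (fun t => G t * S t * (G t)ᴴ)
      (G t * P t * (1 + jMat p) * (G t * P t)ᴴ) (Set.Ici 0) t := by
    intro t ht
    refine (((hGd t).mul (h.deriv_S t ht)).mul (hGd t).conjTranspose).congr_deriv ?_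
    have hid := h.identity ht
    have e1 : -(Complex.I • A * G t) * S t * (G t)ᴴ + G t * S t * (-(Complex.I • A * G t))ᴴ =
        -(Complex.I • (G t * (A * S t - S t * Aᴴ) * (G t)ᴴ)) := by
      have : (A * G t)ᴴ = Aᴴ * (G t)ᴴ := by
        rw [hcomm, Matrix.conjTranspose_mul]
      rw [Matrix.smul_mul, Matrix.conjTranspose_neg, Matrix.conjTranspose_smul, this, hcomm]
      simp only [Matrix.mul_sub, Matrix.sub_mul, Matrix.neg_mul, Matrix.mul_neg, Matrix.smul_mul,
        Matrix.mul_smul, Matrix.mul_assoc, Complex.star_def, Complex.conj_I]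
      module
    rw [hid] at e1
    rw [Matrix.add_mul, add_right_comm, e1]
    simp only [Matrix.mul_add, Matrix.add_mul, Matrix.smul_mul, Matrix.mul_smul,
      Matrix.conjTranspose_mul, Matrix.mul_assoc, smul_smul, Complex.I_mul_I, Matrix.one_mul]
    module
  have hj : (1 + jMat p) = (2 : ℂ) • ((Matrix.fromBlocks 1 0 0 0) *
      (Matrix.fromBlocks 1 0 0 0 : Matrix (Fin p ⊕ Fin p) (Fin p ⊕ Fin p) ℂ)ᴴ) := by
    rw [Matrix.fromBlocks_conjTranspose, Matrix.fromBlocks_multiply, jMat, ← Matrix.fromBlocks_one,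
      Matrix.fromBlocks_add, Matrix.fromBlocks_smul]
    simp [one_add_one_eq_two, two_smul ℂ (1 : Matrix (Fin p) (Fin p) ℂ)]
  have hpsd : ∀ t, 0 ≤ t → (G t * P t * (1 + jMat p) * (G t * P t)ᴴ).PosSemidef := by
    intro t _
    rw [hj, Matrix.mul_smul, Matrix.smul_mul]
    refine Matrix.PosSemidef.smul ?_ (by norm_num)
    exact (Matrix.posSemidef_self_mul_conjTranspose _).mul_mul_conjTranspose_same _
  have hinc := posSemidef_sub_of_hasMatDeriv hT hpsd
    (fun t ht => by simp [Matrix.conjTranspose_mul, h.isHermitian ht, Matrix.mul_assoc]) hx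
  have hG0 : G 0 = 1 := by simp [hG, expI_zero]
  have hpos : (G x * S x * (G x)ᴴ).PosDef := by
    have := h.posDef_zero.add_posSemidef hinc
    simpa [hG0] using this
  have hu : expI A x * G x = 1 := expI_mul_expI_neg A x
  have hinj : Function.Injective (expI A x).vecMul :=
    Matrix.vecMul_injective_of_isUnit
      ((Matrix.isUnit_iff_isUnit_det _).mpr (Matrix.isUnit_det_of_right_inverse hu))
  have := hpos.mul_mul_conjTranspose_same hinj
  have e : expI A x * (G x * S x * (G x)ᴴ) * (expI A x)ᴴ =
      (expI A x * G x) * S x * (expI A x * G x)ᴴ := by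
    simp only [Matrix.conjTranspose_mul, Matrix.mul_assoc]
  rwa [e, hu, Matrix.one_mul, Matrix.conjTranspose_one, Matrix.mul_one] at this

theorem isUnit_S (h : IsDarbouxData A v P S) {x : ℝ} (hx : 0 ≤ x) : IsUnit (S x) :=
  (h.posDef hx).isUnit

/-- The operator identity multiplied by `S⁻¹` on both sides; it serves to move `A*` across `S⁻¹`, so
that only `A` remains in later computations. -/
theorem conjTranspose_mul_inv (h : IsDarbouxData A v P S) {x : ℝ} (hx : 0 ≤ x) :
    Aᴴ * (S x)⁻¹ = (S x)⁻¹ * A - Complex.I • ((S x)⁻¹ * P x * (P x)ᴴ * (S x)⁻¹) := by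
  have hdet := (Matrix.isUnit_iff_isUnit_det _).mp (h.isUnit_S hx)
  have h1 : (S x)⁻¹ * (A * S x - S x * Aᴴ) * (S x)⁻¹ = (S x)⁻¹ * A - Aᴴ * (S x)⁻¹ := by
    rw [Matrix.mul_sub, Matrix.sub_mul, ← Matrix.mul_assoc, Matrix.mul_assoc _ (S x),
      Matrix.mul_nonsing_inv _ hdet, Matrix.mul_one, ← Matrix.mul_assoc,
      Matrix.nonsing_inv_mul _ hdet, Matrix.one_mul]
  rw [h.identity hx, Matrix.mul_smul, Matrix.smul_mul, ← Matrix.mul_assoc] at h1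
  rw [h1]
  abel

/-- `Π* S⁻¹` solves the transformed system with the spectral parameter replaced by right
multiplication by `A`. This is what makes the Darboux matrix intertwine the two systems. -/
theorem deriv_gamma (h : IsDarbouxData A v P S) {x : ℝ} (hx : 0 ≤ x) :
    HasMatDeriv (fun t => (P t)ᴴ * (S t)⁻¹)
      (Complex.I • (jMat p * ((P x)ᴴ * (S x)⁻¹) * A) +
        jMat p * potential (darbouxPotential (v x) (P x) (S x)) * ((P x)ᴴ * (S x)⁻¹))
      (Set.Ici 0) x := by
  refine ((h.deriv_P_conjTranspose hx).mul
    ((h.deriv_S x hx).inv (h.isUnit_S hx))).congr_deriv ?_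
  rw [jMat_mul_potential_darboux _ _ (h.isHermitian hx), Matrix.add_mul, Matrix.smul_mul,
    Matrix.mul_assoc _ Aᴴ, h.conjTranspose_mul_inv hx, gramMat]
  simp only [Matrix.mul_sub, Matrix.sub_mul, Matrix.add_mul, Matrix.mul_smul,
    Matrix.mul_neg, Matrix.mul_assoc, smul_sub, smul_smul, Complex.I_mul_I]
  module

/-- The Darboux matrix maps solutions of the system to solutions of the transformed system. -/
theorem deriv_darbouxMat_mul (h : IsDarbouxData A v P S) {z : ℂ} (hz : IsUnit (A - z • 1))
    {k : Type*} {U : ℝ → Matrix (Fin p ⊕ Fin p) k ℂ} {x : ℝ} (hx : 0 ≤ x)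
    (hU : HasMatDeriv U (systemMat (v x) z * U x) (Set.Ici 0) x) :
    HasMatDeriv (fun t => darbouxMat A (P t) (S t) z * U t)
      (systemMat (darbouxPotential (v x) (P x) (S x)) z *
        (darbouxMat A (P x) (S x) z * U x)) (Set.Ici 0) x := by
  have hdet := (Matrix.isUnit_iff_isUnit_det _).mp hz
  have hw := ((HasMatDeriv.const (1 : Matrix (Fin p ⊕ Fin p) (Fin p ⊕ Fin p) ℂ)).sub
    (HasMatDeriv.smul (hasDerivWithinAt_const x _ Complex.I)
      (((h.deriv_gamma hx).mul (HasMatDeriv.const (A - z • 1)⁻¹)).mul (h.deriv_P x hx)))).mul hU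
  refine hw.congr_deriv ?_
  -- Next to the resolvent, `A` can be traded for `z` plus a term without resolvent. After this both
  -- sides are linear combinations of the same monomials.
  have hR : A * (A - z • 1)⁻¹ = 1 + z • (A - z • 1)⁻¹ := by
    have := Matrix.mul_nonsing_inv _ hdet
    rw [Matrix.sub_mul, Matrix.smul_mul, Matrix.one_mul] at this
    exact sub_eq_iff_eq_add.mp this
  have hR' : (A - z • 1)⁻¹ * A = 1 + z • (A - z • 1)⁻¹ := by
    have := Matrix.nonsing_inv_mul _ hdet
    rw [Matrix.mul_sub, Matrix.mul_smul, Matrix.mul_one] at this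
    exact sub_eq_iff_eq_add.mp this
  rw [systemMat, systemMat, jMat_mul_potential_darboux _ _ (h.isHermitian hx), darbouxMat, gramMat]
  generalize (A - z • 1)⁻¹ = R at *
  have e1 : ∀ {l : Type} (M : Matrix (Fin n) l ℂ), A * (R * M) = M + z • (R * M) := by
    intro l M
    rw [← Matrix.mul_assoc, hR, Matrix.add_mul, Matrix.one_mul, Matrix.smul_mul]
  have e2 : ∀ {l : Type} (M : Matrix (Fin n) l ℂ), R * (A * M) = M + z • (R * M) := by
    intro l M
    rw [← Matrix.mul_assoc, hR', Matrix.add_mul, Matrix.one_mul, Matrix.smul_mul]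
  rw [← Matrix.mul_assoc (_ + _) (1 - _), ← Matrix.mul_assoc _ _ (U x), ← Matrix.add_mul]
  congr 1
  simp only [Matrix.mul_sub, Matrix.sub_mul, Matrix.mul_add, Matrix.add_mul, Matrix.mul_smul,
    Matrix.smul_mul, Matrix.mul_zero, Matrix.zero_mul, zero_smul,
    Matrix.mul_neg, Matrix.mul_assoc, smul_sub, smul_add, smul_neg, smul_smul, Complex.I_mul_I,
    Matrix.mul_one, Matrix.one_mul, e1, e2]
  module

/-- The Gram identity for the Darboux matrix. -/
theorem darbouxMat_gram (h : IsDarbouxData A v P S) {z : ℂ} (hz : IsUnit (A - z • 1))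
    {x : ℝ} (hx : 0 ≤ x) :
    (darbouxMat A (P x) (S x) z)ᴴ * darbouxMat A (P x) (S x) z =
      1 + (2 * z.im : ℂ) •
        (((A - z • 1)⁻¹ * P x)ᴴ * (S x)⁻¹ * ((A - z • 1)⁻¹ * P x)) := by
  have hdet := (Matrix.isUnit_iff_isUnit_det _).mp hz
  have hSi : ((S x)⁻¹)ᴴ = (S x)⁻¹ := by
    rw [Matrix.conjTranspose_nonsing_inv, h.isHermitian hx]
  have hA := h.conjTranspose_mul_inv hx
  set F := (A - z • 1)⁻¹ * P x with hF
  have hP : P x = A * F - z • F := by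
    have : (A - z • 1) * F = P x := by
      rw [hF, ← Matrix.mul_assoc, Matrix.mul_nonsing_inv _ hdet, Matrix.one_mul]
    rw [← this, Matrix.sub_mul, Matrix.smul_mul, Matrix.one_mul]
  have hw : darbouxMat A (P x) (S x) z = 1 - Complex.I • ((P x)ᴴ * ((S x)⁻¹ * F)) := by
    rw [darbouxMat, hF]; simp only [Matrix.mul_assoc]
  have hPc : (P x)ᴴ = Fᴴ * Aᴴ - star z • Fᴴ := by
    rw [hP, Matrix.conjTranspose_sub, Matrix.conjTranspose_smul, Matrix.conjTranspose_mul]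
  set Y := Fᴴ * (S x)⁻¹ * P x with hY
  set G := Fᴴ * (S x)⁻¹ * F with hG
  have hYc : Yᴴ = (P x)ᴴ * ((S x)⁻¹ * F) := by
    rw [hY, Matrix.conjTranspose_mul, Matrix.conjTranspose_mul, hSi,
      Matrix.conjTranspose_conjTranspose]
  have hY1 : Y = Fᴴ * (S x)⁻¹ * A * F - z • G := by
    rw [hY, hP, Matrix.mul_sub, Matrix.mul_smul, ← Matrix.mul_assoc]
  have hY2 : Yᴴ = Fᴴ * (S x)⁻¹ * A * F - Complex.I • (Y * Yᴴ) - star z • G := by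
    have e : Fᴴ * (Aᴴ * (S x)⁻¹) * F = Fᴴ * (S x)⁻¹ * A * F - Complex.I • (Y * Yᴴ) := by
      rw [hA, hYc, hY]
      simp only [Matrix.mul_sub, Matrix.sub_mul, Matrix.mul_smul, Matrix.smul_mul,
        Matrix.mul_assoc]
    rw [← e, hYc, hPc, Matrix.sub_mul, Matrix.smul_mul, hG]
    simp only [Matrix.mul_assoc]
  have hz2 : Complex.I * (z - star z) = -(2 * z.im : ℂ) := by
    apply Complex.ext <;> simp; ring
  -- The skew part of `Y` is computed by writing `Π` as `(A - z) F` in `Y` and in its adjoint: the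
  -- terms with `A` cancel, leaving the quadratic term `Y Y*` and a multiple of `Im z`.
  have key : Complex.I • Y - Complex.I • Yᴴ + Y * Yᴴ = (2 * z.im : ℂ) • G := by
    have : Y - Yᴴ = Complex.I • (Y * Yᴴ) - (z - star z) • G := by
      conv_lhs => rw [hY2]
      conv_lhs => enter [1]; rw [hY1]
      module
    rw [← smul_sub, this, smul_sub, smul_smul, smul_smul, hz2, Complex.I_mul_I]
    module
  rw [hw, ← hYc, ← key, Matrix.conjTranspose_sub, Matrix.conjTranspose_smul,
    Matrix.conjTranspose_conjTranspose, Matrix.conjTranspose_one]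
  simp only [Matrix.mul_sub, Matrix.sub_mul, Matrix.mul_smul, Matrix.smul_mul, Matrix.mul_one,
    Matrix.one_mul, smul_smul, smul_sub, Complex.star_def, Complex.conj_I]
  match_scalars
  all_goals simp

end IsDarbouxData

/-! ### Frobenius norm estimates. -/

section Frobenius

variable {m k l : Type*} [Fintype m] [Fintype k] [Fintype l]

theorem frobenius_norm_sq (F : Matrix m k ℂ) : ‖F‖ ^ 2 = ∑ i, ∑ j, ‖F i j‖ ^ 2 := by
  rw [Matrix.frobenius_norm_def, ← Real.sqrt_eq_rpow, Real.sq_sqrt]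
  · simp
  · positivity

theorem trace_conjTranspose_mul_self (F : Matrix m k ℂ) :
    (Fᴴ * F).trace = ((‖F‖ ^ 2 : ℝ) : ℂ) := by
  rw [frobenius_norm_sq, Finset.sum_comm]
  simp [Matrix.trace, Matrix.mul_apply, Complex.conj_mul']

theorem norm_entry_le (F : Matrix m k ℂ) (i : m) (j : k) : ‖F i j‖ ≤ ‖F‖ := by
  refine le_of_sq_le_sq ?_ (norm_nonneg _)
  rw [frobenius_norm_sq]
  exact (Finset.single_le_sum (f := fun j => ‖F i j‖ ^ 2) (fun _ _ => by positivity)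
    (Finset.mem_univ j)).trans (Finset.single_le_sum (f := fun i => ∑ j, ‖F i j‖ ^ 2)
      (fun _ _ => by positivity) (Finset.mem_univ i))

theorem exists_norm_le_of_entries (m k : Type*) [Fintype m] [Fintype k] :
    ∃ C : ℝ, 0 ≤ C ∧ ∀ (F : Matrix m k ℂ) (K : ℝ), 0 ≤ K → (∀ i j, ‖F i j‖ ≤ K) →
      ‖F‖ ≤ C * K := by
  refine ⟨Fintype.card m * Fintype.card k, by positivity, fun F K hK hF => ?_⟩
  refine le_of_sq_le_sq ?_ (by positivity)
  rw [frobenius_norm_sq]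
  have h1 : ∑ i, ∑ j, ‖F i j‖ ^ 2 ≤ ∑ _i : m, ∑ _j : k, K ^ 2 := by
    gcongr with i _ j _
    exact hF i j
  refine h1.trans ?_
  simp only [Finset.sum_const, Finset.card_univ, nsmul_eq_mul, ← mul_assoc]
  rw [mul_pow]
  gcongr
  -- The sum has `N = |m| |k|` terms, and `N ≤ N²` for every natural number, so `N` can replace `√N`
  -- as the constant.
  exact_mod_cast Nat.le_self_pow two_ne_zero (Fintype.card m * Fintype.card k)

theorem norm_fromRows_sq (F : Matrix m k ℂ) (G : Matrix l k ℂ) :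
    ‖Matrix.fromRows F G‖ ^ 2 = ‖F‖ ^ 2 + ‖G‖ ^ 2 := by
  simp only [frobenius_norm_sq, Fintype.sum_sum_type, Matrix.fromRows_apply_inl,
    Matrix.fromRows_apply_inr]

/-- The factor `‖1‖` is needed because the Frobenius norm of the identity is not `1` in general. -/
theorem isUnit_sub_smul_one [DecidableEq m] {K : Matrix m m ℂ} {z : ℂ}
    (h : ‖K‖ * ‖(1 : Matrix m m ℂ)‖ < ‖z‖) : IsUnit (K - z • 1) := by
  have := spectrum.mem_resolventSet_of_norm_lt_mul h
  rw [spectrum.mem_resolventSet_iff, Algebra.algebraMap_eq_smul_one] at this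
  rw [← neg_sub]
  exact this.neg

/-- The inverse `R` satisfies `z R = K R - 1`, hence `(‖z‖ - ‖K‖) ‖R‖ ≤ ‖1‖`. -/
theorem norm_inv_sub_smul_one_le [DecidableEq m] {K : Matrix m m ℂ} {z : ℂ}
    (hu : IsUnit (K - z • 1)) (h : ‖K‖ + 1 ≤ ‖z‖) :
    ‖(K - z • 1)⁻¹‖ ≤ ‖(1 : Matrix m m ℂ)‖ := by
  have h1 := Matrix.mul_nonsing_inv _ ((Matrix.isUnit_iff_isUnit_det _).mp hu)
  generalize (K - z • 1)⁻¹ = R at h1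
  rw [Matrix.sub_mul, Matrix.smul_mul, Matrix.one_mul, sub_eq_iff_eq_add] at h1
  have h2 : z • R = K * R - 1 := by rw [h1]; abel
  have h3 : ‖z‖ * ‖R‖ ≤ ‖K‖ * ‖R‖ + ‖(1 : Matrix m m ℂ)‖ := by
    rw [← norm_smul, h2]
    exact (norm_sub_le _ _).trans (add_le_add_left (Matrix.frobenius_norm_mul _ _) _)
  nlinarith [norm_nonneg R]

end Frobenius

/-! ### Bounds on the Darboux matrix, uniform in `x`. -/

namespace IsDarbouxData

variable {A : Matrix (Fin n) (Fin n) ℂ} {v : ℝ → Matrix (Fin p) (Fin p) ℂ}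
  {P : ℝ → Matrix (Fin n) (Fin p ⊕ Fin p) ℂ} {S : ℝ → Matrix (Fin n) (Fin n) ℂ}

/-- By cyclicity the trace is that of `S⁻¹ Π Π* = -i S⁻¹ (A S - S A*)`, in which `S` cancels.
Positivity of the Gram matrix then turns this constant trace into a norm bound independent of `x`.
-/
theorem trace_gramMat (h : IsDarbouxData A v P S) {x : ℝ} (hx : 0 ≤ x) :
    (gramMat (P x) (S x)).trace = ((2 * A.trace.im : ℝ) : ℂ) := by
  have hdet := (Matrix.isUnit_iff_isUnit_det _).mp (h.isUnit_S hx)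
  have h1 : (gramMat (P x) (S x)).trace = ((S x)⁻¹ * (P x * (P x)ᴴ)).trace := by
    rw [gramMat, Matrix.mul_assoc, Matrix.trace_mul_comm, Matrix.mul_assoc]
  have h2 : P x * (P x)ᴴ = (-Complex.I) • (A * S x - S x * Aᴴ) := by
    rw [h.identity hx, smul_smul]; simp
  rw [h1, h2, Matrix.mul_smul, Matrix.trace_smul, Matrix.mul_sub, Matrix.trace_sub,
    Matrix.trace_mul_comm, Matrix.mul_assoc, Matrix.mul_nonsing_inv _ hdet, ← Matrix.mul_assoc,
    Matrix.nonsing_inv_mul _ hdet, Matrix.mul_one, Matrix.one_mul, Matrix.trace_conjTranspose]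
  apply Complex.ext <;> simp; ring

theorem exists_factor (h : IsDarbouxData A v P S) {x : ℝ} (hx : 0 ≤ x) :
    ∃ B : Matrix (Fin n) (Fin n) ℂ, (S x)⁻¹ = Bᴴ * B ∧ ‖B * P x‖ ^ 2 = 2 * A.trace.im := by
  obtain ⟨B, hB⟩ := exists_eq_conjTranspose_mul_self (h.posDef hx).inv.posSemidef
  refine ⟨B, hB, ?_⟩
  have h1 := h.trace_gramMat hx
  have h2 : gramMat (P x) (S x) = (B * P x)ᴴ * (B * P x) := by
    rw [gramMat, hB, Matrix.conjTranspose_mul]; simp only [Matrix.mul_assoc]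
  rw [h2, trace_conjTranspose_mul_self] at h1
  exact_mod_cast h1

theorem norm_gramMat_le (h : IsDarbouxData A v P S) {x : ℝ} (hx : 0 ≤ x) :
    ‖gramMat (P x) (S x)‖ ≤ 2 * A.trace.im := by
  obtain ⟨B, hB, hn⟩ := h.exists_factor hx
  have h2 : gramMat (P x) (S x) = (B * P x)ᴴ * (B * P x) := by
    rw [gramMat, hB, Matrix.conjTranspose_mul]; simp only [Matrix.mul_assoc]
  rw [h2, ← hn, sq]
  exact (Matrix.frobenius_norm_mul _ _).trans_eq (by rw [Matrix.frobenius_norm_conjTranspose])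

/-- With `S⁻¹ = B* B`, the Gram identity gives `‖wU‖² = ‖U‖² + 2 Im z ‖G‖²`, while `wU` differs from
`U` by a term of norm `g` with `g² ≤ 2 Im tr A ‖G‖²`. When `Im z ≥ 2 Im tr A`, this gives `‖U‖² + 2
g² ≤ (‖U‖ + g)²`, so `g ≤ 2 ‖U‖`. -/
theorem norm_darbouxMat_mul_le (h : IsDarbouxData A v P S) {z : ℂ} (hz : IsUnit (A - z • 1))
    (hz' : 2 * A.trace.im ≤ z.im) {x : ℝ} (hx : 0 ≤ x) {k : Type*} [Fintype k]
    (U : Matrix (Fin p ⊕ Fin p) k ℂ) : ‖darbouxMat A (P x) (S x) z * U‖ ≤ 3 * ‖U‖ := by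
  obtain ⟨B, hB, hn⟩ := h.exists_factor hx
  set w := darbouxMat A (P x) (S x) z with hw
  set G := B * ((A - z • 1)⁻¹ * P x * U) with hG
  have h1 : (w * U)ᴴ * (w * U) = Uᴴ * U + (2 * z.im : ℂ) • (Gᴴ * G) := by
    have : (w * U)ᴴ * (w * U) = Uᴴ * (wᴴ * w) * U := by
      rw [Matrix.conjTranspose_mul]; simp only [Matrix.mul_assoc]
    rw [this, h.darbouxMat_gram hz hx, hB, hG]
    simp only [Matrix.mul_add, Matrix.add_mul, Matrix.mul_smul, Matrix.smul_mul, Matrix.mul_one,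
      Matrix.conjTranspose_mul, Matrix.mul_assoc]
  have h2 : ‖w * U‖ ^ 2 = ‖U‖ ^ 2 + 2 * z.im * ‖G‖ ^ 2 := by
    have := congrArg Matrix.trace h1
    rw [Matrix.trace_add, Matrix.trace_smul, trace_conjTranspose_mul_self,
      trace_conjTranspose_mul_self, trace_conjTranspose_mul_self, smul_eq_mul] at this
    exact_mod_cast this
  have h3 : w * U = U - Complex.I • ((B * P x)ᴴ * G) := by
    rw [hw, darbouxMat, hB, hG]
    simp only [Matrix.sub_mul, Matrix.smul_mul, Matrix.one_mul, Matrix.conjTranspose_mul,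
      Matrix.mul_assoc]
  set g := ‖(B * P x)ᴴ * G‖ with hg
  have h4 : ‖w * U‖ ≤ ‖U‖ + g := by
    rw [h3]
    refine (norm_sub_le _ _).trans_eq ?_
    rw [norm_smul, Complex.norm_I, one_mul]
  have h5 : g ^ 2 ≤ 2 * A.trace.im * ‖G‖ ^ 2 := by
    rw [← hn, ← mul_pow]
    refine pow_le_pow_left₀ (norm_nonneg _) ?_ 2
    refine (Matrix.frobenius_norm_mul _ _).trans_eq ?_
    rw [Matrix.frobenius_norm_conjTranspose]
  have hg0 : 0 ≤ g := norm_nonneg _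
  have h6 : g ≤ 2 * ‖U‖ := by
    have h7 : ‖w * U‖ ^ 2 ≤ (‖U‖ + g) ^ 2 := pow_le_pow_left₀ (norm_nonneg _) h4 2
    have h8 : 2 * A.trace.im * ‖G‖ ^ 2 ≤ z.im * ‖G‖ ^ 2 := by gcongr
    have h9 : g * g ≤ g * (2 * ‖U‖) := by nlinarith
    rcases hg0.eq_or_lt with h0 | h0
    · rw [← h0]; positivity
    · exact le_of_mul_le_mul_left h9 h0
  linarith

theorem isUnit_darbouxMat (h : IsDarbouxData A v P S) {z : ℂ} (hz : IsUnit (A - z • 1))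
    (hz' : 0 ≤ z.im) {x : ℝ} (hx : 0 ≤ x) : IsUnit (darbouxMat A (P x) (S x) z) := by
  have h1 := h.darbouxMat_gram hz hx
  have h2 : ((darbouxMat A (P x) (S x) z)ᴴ * darbouxMat A (P x) (S x) z).PosDef := by
    rw [h1]
    refine Matrix.PosDef.one.add_posSemidef (Matrix.PosSemidef.smul ?_ ?_)
    · exact (h.posDef hx).inv.posSemidef.conjTranspose_mul_mul_same _
    · have : (0 : ℂ) ≤ z.im := by exact_mod_cast hz'
      positivity
  have h3 := (Matrix.isUnit_iff_isUnit_det _).mp h2.isUnit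
  rw [Matrix.det_mul] at h3
  exact (Matrix.isUnit_iff_isUnit_det _).mpr (isUnit_of_mul_isUnit_right h3)

end IsDarbouxData

/-! ### The explicit `Π` and `S` as Darboux data for the initial potential. -/

theorem systemMat_eq_fromBlocks (v : Matrix (Fin p) (Fin p) ℂ) (z : ℂ) :
    systemMat v z = Matrix.fromBlocks ((Complex.I * z) • 1) v (-vᴴ) (-((Complex.I * z) • 1)) := by
  simp [systemMat, jMat, potential, Matrix.fromBlocks_multiply, Matrix.fromBlocks_smul,
    Matrix.fromBlocks_add]

section Initial

variable {a : ℂ} {c : ℝ} {A Q S0 : Matrix (Fin n) (Fin n) ℂ} {f1 f2 : Matrix (Fin n) (Fin p) ℂ}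

theorem star_initialPotential (a : ℂ) (c x : ℝ) :
    (initialPotential p a c x)ᴴ = (star a * Complex.exp (-(2 * Complex.I * c * x))) • 1 := by
  rw [initialPotential, Matrix.conjTranspose_smul, Matrix.conjTranspose_one, star_mul',
    Complex.star_def, ← Complex.exp_conj]
  simp [Complex.conj_ofNat]

/-- Since `A` and `Q` commute, `(Q - A + c)(Q + A - c) = Q² - (A - c)² = |a|²`. Hence the formula
defining `f₃` from `f₁` can be inverted, and both differential equations for the `e^{ixQ}` part
hold. -/
theorem f3_relations (ha : a ≠ 0) (hcomm : A * Q = Q * A)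
    (hQ : Q ^ 2 = (A - (c : ℂ) • 1) ^ 2 + ((‖a‖ : ℂ) ^ 2) • 1) :
    star a • f3 a c A Q f1 = Complex.I • ((Q + A - (c : ℂ) • 1) * f1) ∧
    Complex.I • ((Q - A + (c : ℂ) • 1) * f3 a c A Q f1) = -(a • f1) := by
  have ha' : star a ≠ 0 := star_ne_zero.mpr ha
  have hn : ((‖a‖ : ℂ) ^ 2) = star a * a := (Complex.conj_mul' a).symm
  refine ⟨?_, ?_⟩
  · rw [f3, smul_smul, mul_div_cancel₀ _ ha']
  · have e : (Q - A + (c : ℂ) • 1) * (Q + A - (c : ℂ) • 1) = (star a * a) • 1 := by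
      rw [← hn]
      have : (Q - A + (c : ℂ) • 1) * (Q + A - (c : ℂ) • 1) =
          Q ^ 2 - (A - (c : ℂ) • 1) ^ 2 + (Q * A - A * Q) := by
        simp only [sq, mul_add, add_mul, mul_sub, sub_mul, Matrix.smul_mul, Matrix.mul_smul,
          mul_one, one_mul]
        module
      rw [this, hQ, hcomm]; abel
    rw [f3, Matrix.mul_smul, ← Matrix.mul_assoc, e, Matrix.smul_mul, Matrix.one_mul, smul_smul,
      smul_smul, ← neg_smul]
    congr 1
    field_simp
    simp

theorem f4_relations (ha : a ≠ 0) (hcomm : A * Q = Q * A)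
    (hQ : Q ^ 2 = (A - (c : ℂ) • 1) ^ 2 + ((‖a‖ : ℂ) ^ 2) • 1) :
    star a • f4 a c A Q f2 = -(Complex.I • ((Q - A + (c : ℂ) • 1) * f2)) ∧
    Complex.I • ((Q + A - (c : ℂ) • 1) * f4 a c A Q f2) = a • f2 := by
  -- The construction is symmetric under `Q ↦ -Q`, which exchanges the two exponentials.
  have e : ∀ f : Matrix (Fin n) (Fin p) ℂ, f4 a c A Q f = f3 a c A (-Q) f := by
    intro f
    rw [f3, f4, neg_smul, ← smul_neg, ← Matrix.neg_mul]
    congr 2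
    abel
  obtain ⟨h1, h2⟩ := f3_relations (f1 := f2) (A := A) (Q := -Q) ha (by simp [hcomm])
    (by simpa using hQ)
  rw [e, h1]
  refine ⟨?_, ?_⟩
  · rw [← smul_neg, ← Matrix.neg_mul]; congr 2; abel
  · rw [← neg_inj, ← h2, ← smul_neg, ← Matrix.neg_mul]; congr 2; abel

theorem hasMatDeriv_Lam1 (ha : a ≠ 0) (hcomm : A * Q = Q * A)
    (hQ : Q ^ 2 = (A - (c : ℂ) • 1) ^ 2 + ((‖a‖ : ℂ) ^ 2) • 1) (s : Set ℝ) (x : ℝ) :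
    HasMatDeriv (Lam1 c Q f1 f2) (-(Complex.I • (A * Lam1 c Q f1 f2 x)) +
      Lam2 a c A Q f1 f2 x * (initialPotential p a c x)ᴴ) s x := by
  have he : HasDerivWithinAt (fun t : ℝ => Complex.exp (-(Complex.I * c * t)))
      (Complex.exp (-(Complex.I * c * x)) * -(Complex.I * c)) s x := by
    have : HasDerivAt (fun t : ℝ => -(Complex.I * c * t)) (-(Complex.I * c * 1)) x :=
      ((Complex.ofRealCLM.hasDerivAt).const_mul _).neg
    simpa using this.cexp.hasDerivWithinAt (s := s)
  refine (HasMatDeriv.smul he (((hasMatDeriv_expI Q s x).mul (HasMatDeriv.const f1)).add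
    ((hasMatDeriv_expI_neg Q s x).mul (HasMatDeriv.const f2)))).congr_deriv ?_
  have hA : ∀ t (M : Matrix (Fin n) (Fin p) ℂ), A * (expI Q t * M) = expI Q t * (A * M) :=
    fun t M => by rw [← Matrix.mul_assoc, commute_expI hcomm, Matrix.mul_assoc]
  have hQE : ∀ t (M : Matrix (Fin n) (Fin p) ℂ), Q * (expI Q t * M) = expI Q t * (Q * M) :=
    fun t M => by rw [← Matrix.mul_assoc, commute_expI (Commute.refl Q), Matrix.mul_assoc]
  have h3 := (f3_relations (f1 := f1) ha hcomm hQ).1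
  have h4 := (f4_relations (f2 := f2) ha hcomm hQ).1
  have e1 : Lam2 a c A Q f1 f2 x * (initialPotential p a c x)ᴴ =
      Complex.exp (-(Complex.I * c * x)) • (expI Q x * (star a • f3 a c A Q f1) +
        expI Q (-x) * (star a • f4 a c A Q f2)) := by
    have : Complex.exp (-(Complex.I * c * x)) =
        Complex.exp (-(2 * Complex.I * c * x)) * Complex.exp (Complex.I * c * x) := by
      rw [← Complex.exp_add]; congr 1; ring
    rw [star_initialPotential, Matrix.mul_smul, Matrix.mul_one, Lam2, this, Matrix.mul_smul,
      Matrix.mul_smul]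
    module
  rw [e1, h3, h4, Lam1]
  simp only [Matrix.mul_add, Matrix.add_mul, Matrix.mul_sub, Matrix.sub_mul, Matrix.mul_smul,
    Matrix.smul_mul, Matrix.mul_neg, Matrix.neg_mul, Matrix.mul_zero, Matrix.one_mul, hA, hQE,
    Matrix.mul_assoc]
  module

theorem hasMatDeriv_Lam2 (ha : a ≠ 0) (hcomm : A * Q = Q * A)
    (hQ : Q ^ 2 = (A - (c : ℂ) • 1) ^ 2 + ((‖a‖ : ℂ) ^ 2) • 1) (s : Set ℝ) (x : ℝ) :
    HasMatDeriv (Lam2 a c A Q f1 f2) (Complex.I • (A * Lam2 a c A Q f1 f2 x) -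
      Lam1 c Q f1 f2 x * initialPotential p a c x) s x := by
  have he : HasDerivWithinAt (fun t : ℝ => Complex.exp (Complex.I * c * t))
      (Complex.exp (Complex.I * c * x) * (Complex.I * c)) s x := by
    have : HasDerivAt (fun t : ℝ => Complex.I * c * t) (Complex.I * c * 1) x :=
      (Complex.ofRealCLM.hasDerivAt).const_mul _
    simpa using this.cexp.hasDerivWithinAt (s := s)
  refine (HasMatDeriv.smul he (((hasMatDeriv_expI Q s x).mul
    (HasMatDeriv.const (f3 a c A Q f1))).add
    ((hasMatDeriv_expI_neg Q s x).mul (HasMatDeriv.const (f4 a c A Q f2))))).congr_deriv ?_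
  have hA : ∀ t (M : Matrix (Fin n) (Fin p) ℂ), A * (expI Q t * M) = expI Q t * (A * M) :=
    fun t M => by rw [← Matrix.mul_assoc, commute_expI hcomm, Matrix.mul_assoc]
  have hQE : ∀ t (M : Matrix (Fin n) (Fin p) ℂ), Q * (expI Q t * M) = expI Q t * (Q * M) :=
    fun t M => by rw [← Matrix.mul_assoc, commute_expI (Commute.refl Q), Matrix.mul_assoc]
  have h3 := (f3_relations (f1 := f1) ha hcomm hQ).2
  have h4 := (f4_relations (f2 := f2) ha hcomm hQ).2
  have e1 : Lam1 c Q f1 f2 x * initialPotential p a c x =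
      Complex.exp (Complex.I * c * x) • (expI Q (-x) * (a • f2) - expI Q x * -(a • f1)) := by
    have : Complex.exp (Complex.I * c * x) =
        Complex.exp (2 * Complex.I * c * x) * Complex.exp (-(Complex.I * c * x)) := by
      rw [← Complex.exp_add]; congr 1; ring
    rw [initialPotential, Matrix.mul_smul, Matrix.mul_one, Lam1, this, Matrix.mul_smul,
      Matrix.mul_neg, Matrix.mul_smul]
    module
  rw [e1, ← h3, ← h4, Lam2]
  simp only [Matrix.mul_add, Matrix.add_mul, Matrix.mul_sub, Matrix.sub_mul, Matrix.mul_smul,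
    Matrix.smul_mul, Matrix.neg_mul, Matrix.mul_zero, Matrix.one_mul, hA, hQE,
    Matrix.mul_assoc]
  module

theorem hasMatDeriv_PiMat (ha : a ≠ 0) (hcomm : A * Q = Q * A)
    (hQ : Q ^ 2 = (A - (c : ℂ) • 1) ^ 2 + ((‖a‖ : ℂ) ^ 2) • 1) (s : Set ℝ) (x : ℝ) :
    HasMatDeriv (PiMat a c A Q f1 f2)
      (-(Complex.I • (A * PiMat a c A Q f1 f2 x * jMat p)) -
        PiMat a c A Q f1 f2 x * (jMat p * potential (initialPotential p a c x))) s x := by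
  refine ((hasMatDeriv_Lam1 ha hcomm hQ s x).fromCols
    (hasMatDeriv_Lam2 ha hcomm hQ s x)).congr_deriv ?_
  have e : jMat p * potential (initialPotential p a c x) = Matrix.fromBlocks 0
      (initialPotential p a c x) (-(initialPotential p a c x)ᴴ) 0 := by
    simp [jMat, potential, Matrix.fromBlocks_multiply]
  rw [e, PiMat, jMat, Matrix.mul_fromCols, Matrix.fromCols_mul_fromBlocks,
    Matrix.fromCols_mul_fromBlocks]
  ext i (j | j) <;> simp

theorem isDarbouxData_initial (ha : a ≠ 0) (hcomm : A * Q = Q * A)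
    (hQ : Q ^ 2 = (A - (c : ℂ) • 1) ^ 2 + ((‖a‖ : ℂ) ^ 2) • 1) (hS0 : S0.PosDef)
    (hid : A * S0 - S0 * Aᴴ = Complex.I • (PiMat a c A Q f1 f2 0 * (PiMat a c A Q f1 f2 0)ᴴ)) :
    IsDarbouxData A (initialPotential p a c) (PiMat a c A Q f1 f2) (SMat a c A Q S0 f1 f2) := by
  have hS : SMat a c A Q S0 f1 f2 0 = S0 := by ext i j; simp [SMat]
  refine ⟨fun x _ => hasMatDeriv_PiMat ha hcomm hQ _ x, fun x _ i k => ?_, ?_, ?_⟩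
  · have hd : ∀ x, HasMatDeriv (PiMat a c A Q f1 f2) _ Set.univ x :=
      hasMatDeriv_PiMat ha hcomm hQ Set.univ
    have hcont : Continuous fun r => (PiMat a c A Q f1 f2 r * jMat p *
        (PiMat a c A Q f1 f2 r)ᴴ) i k := by
      rw [← continuousOn_univ]
      exact fun x _ => ((((hd x).mul (HasMatDeriv.const (jMat p))).mul
        (hd x).conjTranspose) i k).continuousWithinAt
    exact ((hcont.integral_hasStrictDerivAt 0 x).hasDerivAt.const_add _).hasDerivWithinAt
  · rw [hS, hid]
  · rwa [hS]

theorem transformedPotential_eq (x : ℝ) : transformedPotential a c A Q S0 f1 f2 x =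
    darbouxPotential (initialPotential p a c x) (PiMat a c A Q f1 f2 x)
      (SMat a c A Q S0 f1 f2 x) := by
  rw [transformedPotential, darbouxPotential, gramMat, PiMat,
    Matrix.conjTranspose_fromCols_eq_fromRows_conjTranspose, Matrix.fromRows_mul,
    Matrix.fromRows_mul_fromCols, Matrix.toBlocks_fromBlocks₁₂]

end Initial

/-! ### Explicit solution of the initial system. -/

/-- The normalised fundamental solution of the system with potential `a e^{2icx} I`, where
`ζ² = (z - c)² + |a|²`. -/
def initialSol (p : ℕ) (a : ℂ) (c : ℝ) (z ζ : ℂ) (x : ℝ) :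
    Matrix (Fin p ⊕ Fin p) (Fin p ⊕ Fin p) ℂ :=
  Matrix.fromBlocks
    ((Complex.exp (Complex.I * c * x) *
      (Complex.cos (ζ * x) + Complex.I * (z - c) * (Complex.sin (ζ * x) / ζ))) • 1)
    ((Complex.exp (Complex.I * c * x) * (a * (Complex.sin (ζ * x) / ζ))) • 1)
    ((Complex.exp (-(Complex.I * c * x)) * (-star a * (Complex.sin (ζ * x) / ζ))) • 1)
    ((Complex.exp (-(Complex.I * c * x)) *
      (Complex.cos (ζ * x) - Complex.I * (z - c) * (Complex.sin (ζ * x) / ζ))) • 1)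

theorem initialSol_zero (p : ℕ) (a : ℂ) (c : ℝ) (z ζ : ℂ) : initialSol p a c z ζ 0 = 1 := by
  simp [initialSol]

theorem HasMatDeriv.fromBlocks_smul_one {α β γ δ : ℝ → ℂ} {α' β' γ' δ' : ℂ} {s : Set ℝ} {x : ℝ}
    (hα : HasDerivWithinAt α α' s x) (hβ : HasDerivWithinAt β β' s x)
    (hγ : HasDerivWithinAt γ γ' s x) (hδ : HasDerivWithinAt δ δ' s x) :
    HasMatDeriv (fun t => Matrix.fromBlocks (α t • (1 : Matrix (Fin p) (Fin p) ℂ))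
      (β t • (1 : Matrix (Fin p) (Fin p) ℂ)) (γ t • (1 : Matrix (Fin p) (Fin p) ℂ))
      (δ t • (1 : Matrix (Fin p) (Fin p) ℂ)))
      (Matrix.fromBlocks (α' • 1) (β' • 1) (γ' • 1) (δ' • 1)) s x := by
  rintro (i | i) (j | j)
  · exact hα.mul_const ((1 : Matrix (Fin p) (Fin p) ℂ) i j)
  · exact hβ.mul_const ((1 : Matrix (Fin p) (Fin p) ℂ) i j)
  · exact hγ.mul_const ((1 : Matrix (Fin p) (Fin p) ℂ) i j)
  · exact hδ.mul_const ((1 : Matrix (Fin p) (Fin p) ℂ) i j)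

/-- Removing the factor `e^{icxj}` leaves a system with constant coefficient `K = [[i(z-c), a], [-ā,
-i(z-c)]]`. Since `K² = -ζ²`, one has `e^{xK} = cos(ζx) + K sin(ζx)/ζ`. -/
theorem hasMatDeriv_initialSol {a : ℂ} {c : ℝ} {z ζ : ℂ} (hζ0 : ζ ≠ 0)
    (hζ : ζ ^ 2 = (z - c) ^ 2 + (‖a‖ : ℂ) ^ 2) (s : Set ℝ) (x : ℝ) :
    HasMatDeriv (initialSol p a c z ζ)
      (systemMat (initialPotential p a c x) z * initialSol p a c z ζ x) s x := by
  have hid : ∀ k : ℂ, HasDerivAt (fun t : ℝ => k * t) k x := fun k => by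
    simpa using (Complex.ofRealCLM.hasDerivAt (x := x)).const_mul k
  have hep : HasDerivAt (fun t : ℝ => Complex.exp (Complex.I * c * t)) _ x := (hid _).cexp
  have hem : HasDerivAt (fun t : ℝ => Complex.exp (-(Complex.I * c * t))) _ x := (hid _).neg.cexp
  have hc : HasDerivAt (fun t : ℝ => Complex.cos (ζ * t)) _ x := (Complex.hasDerivAt_cos _).comp x (hid ζ)
  have hs : HasDerivAt (fun t : ℝ => Complex.sin (ζ * t) / ζ) _ x := 
    ((Complex.hasDerivAt_sin _).comp x (hid ζ)).div_const ζ
  have hn : (‖a‖ : ℂ) ^ 2 = star a * a := (Complex.conj_mul' a).symm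
  have hexp : Complex.exp (2 * Complex.I * c * x) =
      Complex.exp (Complex.I * c * x) * Complex.exp (Complex.I * c * x) := by
    rw [← Complex.exp_add]; congr 1; ring
  have hexpm : Complex.exp (-(2 * Complex.I * c * x)) =
      Complex.exp (-(Complex.I * c * x)) * Complex.exp (-(Complex.I * c * x)) := by
    rw [← Complex.exp_add]; congr 1; ring
  have hpm : Complex.exp (Complex.I * c * x) * Complex.exp (-(Complex.I * c * x)) = 1 := by
    rw [← Complex.exp_add, add_neg_cancel, Complex.exp_zero]
  refine (HasMatDeriv.fromBlocks_smul_one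
    (hep.mul (hc.add (hs.const_mul (Complex.I * (z - c))))).hasDerivWithinAt
    (hep.mul (hs.const_mul a)).hasDerivWithinAt
    (hem.mul (hs.const_mul (-star a))).hasDerivWithinAt
    (hem.mul (hc.sub (hs.const_mul (Complex.I * (z - c))))).hasDerivWithinAt).congr_deriv ?_
  rw [systemMat_eq_fromBlocks, star_initialPotential, initialPotential, initialSol,
    Matrix.fromBlocks_multiply, hexp, hexpm]
  simp only [Matrix.smul_mul, Matrix.mul_smul, Matrix.one_mul, smul_smul,
    ← add_smul, ← neg_smul, Pi.add_apply, Pi.sub_apply]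
  have hsin : Complex.sin (ζ * x) = ζ * (Complex.sin (ζ * x) / ζ) := by field_simp
  have hcos : Complex.cos (ζ * x) * ζ / ζ = Complex.cos (ζ * x) := by field_simp
  rw [hcos]
  generalize Complex.sin (ζ * x) / ζ = σ at *
  rw [hsin]
  generalize Complex.cos (ζ * x) = κ
  generalize Complex.exp (Complex.I * c * x) = ep at *
  generalize Complex.exp (-(Complex.I * c * x)) = em at *
  rw [hn] at hζ
  generalize star a = b at *
  have hI := Complex.I_sq
  congr 2
  · linear_combination (-ep * σ) * hζ - (ep * σ * (z-c)^2) * hI + (b*a*σ*ep) * hpm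
  · linear_combination (-a * ep * κ + a*ep*σ*Complex.I*(z-c))* hpm
  · linear_combination (b*em*κ + b*em*σ*Complex.I*(z-c))* hpm
  · linear_combination (-em * σ) * hζ - (em * σ * (z-c)^2) * hI + (b*a*σ*em) * hpm

/-! ### The cut half-plane and the branch `ζ`. -/

/-- The part, off the cut, of the half-plane `Im z > M`. -/
def cutHalfPlane (a : ℂ) (c M : ℝ) : Set ℂ := {z | M < z.im ∧ ¬ (z.re = c ∧ z.im ≤ ‖a‖)}

theorem isOpen_halfPlane (M : ℝ) : IsOpen (halfPlane M) :=
  isOpen_lt continuous_const Complex.continuous_im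

theorem isOpen_cutHalfPlane (a : ℂ) (c M : ℝ) : IsOpen (cutHalfPlane a c M) := by
  have : cutHalfPlane a c M = halfPlane M ∩ ({z | z.re ≠ c} ∪ halfPlane ‖a‖) := by
    ext z
    simp only [cutHalfPlane, halfPlane, Set.mem_ofPred_eq, Set.mem_inter_iff, Set.mem_union,
      not_and_or, not_le, ne_eq]
  rw [this]
  exact (isOpen_halfPlane M).inter
    ((isOpen_ne_fun Complex.continuous_re continuous_const).union (isOpen_halfPlane _))

/-- The region is star-shaped about any of its points on the line `Re z = c` above the cut: a
segment from such a point to `z` meets the line again only if `z` lies on it, and then `z` is itself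
above the cut. -/
theorem isPreconnected_cutHalfPlane (a : ℂ) (c M : ℝ) : IsPreconnected (cutHalfPlane a c M) := by
  set T := max M ‖a‖ + 1 with hT
  have hTM : M < T := lt_of_le_of_lt (le_max_left M ‖a‖) (lt_add_one _)
  have hTa : ‖a‖ < T := lt_of_le_of_lt (le_max_right M ‖a‖) (lt_add_one _)
  have hmem : (⟨c, T⟩ : ℂ) ∈ cutHalfPlane a c M :=
    ⟨hTM, fun h => absurd h.2 (not_le.mpr hTa)⟩
  have hstar : StarConvex ℝ (⟨c, T⟩ : ℂ) (cutHalfPlane a c M) := by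
    rw [starConvex_iff_forall_pos hmem]
    rintro z ⟨hz1, hz2⟩ α β hα hβ hαβ
    have him : (α • (⟨c, T⟩ : ℂ) + β • z).im = α * T + β * z.im := by simp
    have hre : (α • (⟨c, T⟩ : ℂ) + β • z).re = α * c + β * z.re := by simp
    have hconv : ∀ m : ℝ, m < T → m < z.im → m < α * T + β * z.im := by
      intro m h1 h2
      have h3 := mul_lt_mul_of_pos_left h1 hα
      have h4 := mul_lt_mul_of_pos_left h2 hβ
      have h5 : α * m + β * m = m := by rw [← add_mul, hαβ, one_mul]
      linarith
    refine ⟨him ▸ hconv M hTM hz1, fun h => ?_⟩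
    · rw [hre, him] at h
      have hzc : z.re = c := by
        have : β * (z.re - c) = 0 := by
          have := h.1
          rw [← sub_eq_zero] at this
          rw [← this, show α = 1 - β by linarith]; ring
        rcases mul_eq_zero.mp this with h0 | h0
        · exact absurd h0 hβ.ne'
        · linarith
      have : ‖a‖ < z.im := not_le.mp fun h' => hz2 ⟨hzc, h'⟩
      exact absurd h.2 (not_le.mpr (hconv _ hTa this))
  exact (hstar.isPathConnected hmem).isConnected.isPreconnected

theorem halfPlane_subset_cutHalfPlane {a : ℂ} {c M M' : ℝ} (h : M ≤ M') (h' : ‖a‖ ≤ M') :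
    halfPlane M' ⊆ cutHalfPlane a c M :=
  fun _ hz => ⟨h.trans_lt hz, fun h0 => absurd (h0.2.trans h') (not_le.mpr hz)⟩

theorem cutHalfPlane_anti {a : ℂ} {c M M' : ℝ} (h : M ≤ M') :
    cutHalfPlane a c M' ⊆ cutHalfPlane a c M :=
  fun _ hz => ⟨h.trans_lt hz.1, hz.2⟩

namespace IsUpperBranch

variable {a : ℂ} {c : ℝ} {ζ : ℂ → ℂ}

theorem hFun_mul (h : IsUpperBranch a c ζ) {z : ℂ} (hz : z ∈ cutHalfPlane a c 0) :
    hFun c ζ z * (z - c + ζ z) = -(‖a‖ : ℂ) ^ 2 := by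
  have := (h z hz.1 hz.2).1
  rw [hFun]
  linear_combination -this

/-- The conjugate root `z - c + ζ` has imaginary part above `|a|`, and its product with `h` has
modulus `|a|²`. -/
theorem norm_hFun_le (h : IsUpperBranch a c ζ) {z : ℂ} (hz : z ∈ halfPlane ‖a‖) :
    ‖hFun c ζ z‖ ≤ ‖a‖ := by
  have hz0 : z ∈ cutHalfPlane a c 0 := halfPlane_subset_cutHalfPlane (norm_nonneg a) le_rfl hz
  have h1 := congrArg norm (h.hFun_mul hz0)
  rw [norm_mul, norm_neg, norm_pow, Complex.norm_real, norm_norm] at h1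
  have h2 : ‖a‖ < ‖z - c + ζ z‖ := by
    have h3 : (z - c + ζ z).im = z.im + (ζ z).im := by simp
    have h4 := Complex.im_le_norm (z - c + ζ z)
    have h5 := (h z hz0.1 hz0.2).2
    have h6 : ‖a‖ < z.im := hz
    linarith
  by_contra hcon
  push Not at hcon
  nlinarith [norm_nonneg a, norm_nonneg (z - c + ζ z)]

theorem ne_zero (h : IsUpperBranch a c ζ) {z : ℂ} (hz : z ∈ cutHalfPlane a c 0) : ζ z ≠ 0 := by
  intro h0
  have := (h z hz.1 hz.2).2
  simp [h0] at this

/-- As `-iζ` has positive real part, it is the principal square root of `-((z-c)² + |a|²)`, and the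
square of such a number avoids the cut of the principal branch. -/
theorem differentiableOn (h : IsUpperBranch a c ζ) :
    DifferentiableOn ℂ ζ (cutHalfPlane a c 0) := by
  have key : ∀ z ∈ cutHalfPlane a c 0,
      0 < (-Complex.I * ζ z).re ∧ -((z - c) ^ 2 + (‖a‖ : ℂ) ^ 2) = (-Complex.I * ζ z) ^ 2 := by
    intro z hz
    obtain ⟨h1, h2⟩ := h z hz.1 hz.2
    refine ⟨by simpa using h2, ?_⟩
    rw [← h1, mul_pow, neg_sq, Complex.I_sq]; ring
  have e : Set.EqOn ζ (fun z => Complex.I * (-((z - c) ^ 2 + (‖a‖ : ℂ) ^ 2)) ^ (2⁻¹ : ℂ))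
      (cutHalfPlane a c 0) := by
    intro z hz
    obtain ⟨h1, h2⟩ := key z hz
    have := Complex.sq_cpow_two_inv h1
    simp only [h2, this]
    rw [← mul_assoc, mul_neg, Complex.I_mul_I]; simp
  refine DifferentiableOn.congr (fun z hz => ?_) e
  obtain ⟨h1, h2⟩ := key z hz
  have hslit : -((z - c) ^ 2 + (‖a‖ : ℂ) ^ 2) ∈ Complex.slitPlane := by
    rw [h2, Complex.mem_slitPlane_iff]
    generalize -Complex.I * ζ z = s at h1
    by_cases h3 : s.im = 0
    · left; simp [sq, h3]; positivity
    · right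
      rw [sq, Complex.mul_im, mul_comm s.im, ← two_mul]
      exact mul_ne_zero two_ne_zero (mul_ne_zero h1.ne' h3)
  have hd : DifferentiableAt ℂ (fun z : ℂ => -((z - c) ^ 2 + (‖a‖ : ℂ) ^ 2)) z := by fun_prop
  exact ((hd.cpow_const hslit).const_mul _).differentiableWithinAt

theorem differentiableOn_hFun (h : IsUpperBranch a c ζ) :
    DifferentiableOn ℂ (hFun c ζ) (cutHalfPlane a c 0) :=
  (differentiableOn_id.sub (differentiableOn_const _)).sub h.differentiableOn

end IsUpperBranch

/-! ### Holomorphic matrix functions. -/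

/-- Entrywise holomorphy of a matrix function. -/
def MatDifferentiableOn {m k : Type*} (F : ℂ → Matrix m k ℂ) (U : Set ℂ) : Prop :=
  ∀ i j, DifferentiableOn ℂ (fun z => F z i j) U

namespace MatDifferentiableOn

variable {m k l : Type*} {U : Set ℂ}

theorem const (F : Matrix m k ℂ) : MatDifferentiableOn (fun _ => F) U :=
  fun i j => differentiableOn_const (F i j)

theorem add {F G : ℂ → Matrix m k ℂ} (hF : MatDifferentiableOn F U)
    (hG : MatDifferentiableOn G U) : MatDifferentiableOn (fun z => F z + G z) U :=
  fun i j => (hF i j).add (hG i j)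

theorem sub {F G : ℂ → Matrix m k ℂ} (hF : MatDifferentiableOn F U)
    (hG : MatDifferentiableOn G U) : MatDifferentiableOn (fun z => F z - G z) U :=
  fun i j => (hF i j).sub (hG i j)

theorem smul {f : ℂ → ℂ} {F : ℂ → Matrix m k ℂ} (hf : DifferentiableOn ℂ f U)
    (hF : MatDifferentiableOn F U) : MatDifferentiableOn (fun z => f z • F z) U :=
  fun i j => hf.mul (hF i j)

theorem mul [Fintype k] {F : ℂ → Matrix m k ℂ} {G : ℂ → Matrix k l ℂ}
    (hF : MatDifferentiableOn F U) (hG : MatDifferentiableOn G U) :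
    MatDifferentiableOn (fun z => F z * G z) U := by
  intro i j
  simp only [Matrix.mul_apply]
  exact DifferentiableOn.fun_sum fun r _ => (hF i r).mul (hG r j)

theorem det [Fintype m] [DecidableEq m] {F : ℂ → Matrix m m ℂ} (hF : MatDifferentiableOn F U) :
    DifferentiableOn ℂ (fun z => (F z).det) U := by
  simp only [Matrix.det_apply]
  exact DifferentiableOn.fun_sum fun σ _ =>
    (DifferentiableOn.fun_finsetProd fun i _ => hF (σ i) i).const_smul _

theorem adjugate [Fintype m] [DecidableEq m] {F : ℂ → Matrix m m ℂ}
    (hF : MatDifferentiableOn F U) : MatDifferentiableOn (fun z => (F z).adjugate) U := by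
  intro i j
  simp only [Matrix.adjugate_apply]
  refine MatDifferentiableOn.det fun r s => ?_
  by_cases h : r = j
  · subst h
    simp only [Matrix.updateRow_self]
    exact differentiableOn_const _
  · simp only [Matrix.updateRow_ne h]
    exact hF r s

theorem inv [Fintype m] [DecidableEq m] {F : ℂ → Matrix m m ℂ} (hF : MatDifferentiableOn F U)
    (hu : ∀ z ∈ U, IsUnit (F z)) : MatDifferentiableOn (fun z => (F z)⁻¹) U := by
  simp only [Matrix.inv_def, Ring.inverse_eq_inv']
  exact MatDifferentiableOn.smul (hF.det.inv fun z hz =>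
    ((Matrix.isUnit_iff_isUnit_det _).mp (hu z hz)).ne_zero) hF.adjugate

theorem mono {F : ℂ → Matrix m k ℂ} {V : Set ℂ} (hF : MatDifferentiableOn F U) (h : V ⊆ U) :
    MatDifferentiableOn F V := fun i j => (hF i j).mono h

end MatDifferentiableOn

/-! ### The Weyl formula: analytic continuation, and its origin in the Darboux matrix. -/

section Formula

variable {a : ℂ} {c : ℝ} {ζ : ℂ → ℂ} {A S0 : Matrix (Fin n) (Fin n) ℂ}
  {L1 L2 : Matrix (Fin n) (Fin p) ℂ}

theorem matDifferentiableOn_BMat (hζ : IsUpperBranch a c ζ) :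
    MatDifferentiableOn (fun z => BMat a (hFun c ζ z) L1 L2) (cutHalfPlane a c 0) :=
  (MatDifferentiableOn.const _).add
    (MatDifferentiableOn.smul hζ.differentiableOn_hFun (MatDifferentiableOn.const _))

theorem matDifferentiableOn_DMat (hζ : IsUpperBranch a c ζ) :
    MatDifferentiableOn (fun z => DMat p (hFun c ζ z)) (cutHalfPlane a c 0) :=
  MatDifferentiableOn.smul hζ.differentiableOn_hFun (MatDifferentiableOn.const _)

theorem matDifferentiableOn_pencil (hζ : IsUpperBranch a c ζ) :
    MatDifferentiableOn (pencil a c ζ A S0 L1 L2) (cutHalfPlane a c 0) :=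
  ((MatDifferentiableOn.const A).sub ((matDifferentiableOn_BMat hζ).mul
    (MatDifferentiableOn.const _))).sub
      (MatDifferentiableOn.smul differentiableOn_id (MatDifferentiableOn.const _))

theorem matDifferentiableOn_weylFormula (hζ : IsUpperBranch a c ζ) {U : Set ℂ}
    (hU : U ⊆ cutHalfPlane a c 0) (hu : ∀ z ∈ U, IsUnit (pencil a c ζ A S0 L1 L2 z)) :
    MatDifferentiableOn (weylFormula a c ζ A S0 L1 L2) U :=
  MatDifferentiableOn.smul (differentiableOn_const _)
    (((matDifferentiableOn_DMat hζ).mono hU).add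
      ((((((matDifferentiableOn_DMat hζ).mul (MatDifferentiableOn.const _)).sub
        (MatDifferentiableOn.const _)).mono hU).mul
          (((matDifferentiableOn_pencil hζ).mono hU).inv hu)).mul
            ((matDifferentiableOn_BMat hζ).mono hU)))

/-- A holomorphic matrix function which equals the Weyl formula high up in the half-plane equals it
wherever the pencil is invertible. -/
theorem eq_weylFormula_of_eqOn (hζ : IsUpperBranch a c ζ) {M M' : ℝ} (hM : 0 < M)
    {ψ : ℂ → Matrix (Fin p) (Fin p) ℂ} (hψ : HolomorphicOn ψ (halfPlane M))
    (heq : ∀ z ∈ halfPlane M', IsUnit (pencil a c ζ A S0 L1 L2 z) ∧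
      ψ z = weylFormula a c ζ A S0 L1 L2 z)
    {z : ℂ} (hz : z ∈ cutHalfPlane a c M) (hu : IsUnit (pencil a c ζ A S0 L1 L2 z)) :
    ψ z = weylFormula a c ζ A S0 L1 L2 z := by
  have hsub : cutHalfPlane a c M ⊆ cutHalfPlane a c 0 := cutHalfPlane_anti hM.le
  -- The formula multiplied by the determinant of the pencil, with the adjugate in place of the
  -- inverse. It is holomorphic on the whole cut half-plane, so the identity theorem need not avoid
  -- the singularities of the pencil.
  set G : ℂ → Matrix (Fin p) (Fin p) ℂ := fun z => (1 / (Complex.I * a)) •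
    ((pencil a c ζ A S0 L1 L2 z).det • DMat p (hFun c ζ z) +
      (DMat p (hFun c ζ z) * C1Mat a S0 L1 - C2Mat S0 L2) *
        (pencil a c ζ A S0 L1 L2 z).adjugate * BMat a (hFun c ζ z) L1 L2) with hG
  have hGd : MatDifferentiableOn G (cutHalfPlane a c M) := by
    refine MatDifferentiableOn.mono ?_ hsub
    exact MatDifferentiableOn.smul (differentiableOn_const _)
      ((MatDifferentiableOn.smul (matDifferentiableOn_pencil hζ).det
        (matDifferentiableOn_DMat hζ)).add
        (((((matDifferentiableOn_DMat hζ).mul (MatDifferentiableOn.const _)).sub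
          (MatDifferentiableOn.const _)).mul (matDifferentiableOn_pencil hζ).adjugate).mul
            (matDifferentiableOn_BMat hζ)))
  have hGeq : ∀ z, IsUnit (pencil a c ζ A S0 L1 L2 z) →
      G z = (pencil a c ζ A S0 L1 L2 z).det • weylFormula a c ζ A S0 L1 L2 z := by
    intro z hu
    have hdet := ((Matrix.isUnit_iff_isUnit_det _).mp hu).ne_zero
    have hadj : (pencil a c ζ A S0 L1 L2 z).adjugate =
        (pencil a c ζ A S0 L1 L2 z).det • (pencil a c ζ A S0 L1 L2 z)⁻¹ := by
      rw [Matrix.inv_def, Ring.inverse_eq_inv', smul_smul, mul_inv_cancel₀ hdet, one_smul]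
    simp only [hG, hadj, weylFormula, Matrix.mul_smul, Matrix.smul_mul]
    module
  have hFd : MatDifferentiableOn (fun z => (pencil a c ζ A S0 L1 L2 z).det • ψ z)
      (cutHalfPlane a c M) :=
    MatDifferentiableOn.smul ((matDifferentiableOn_pencil hζ).mono hsub).det
      (fun i j => (hψ i j).mono fun z hz => hz.1)
  have hmain : (pencil a c ζ A S0 L1 L2 z).det • ψ z = G z := by
    ext i j
    set T := max (max M M') ‖a‖ with hT
    have hz0 : (⟨c, T + 1⟩ : ℂ) ∈ halfPlane T := lt_add_one T
    have hTM : M ≤ T := (le_max_left M M').trans (le_max_left _ _)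
    have hTM' : M' ≤ T := (le_max_right M M').trans (le_max_left _ _)
    have hsubT : halfPlane T ⊆ cutHalfPlane a c M :=
      halfPlane_subset_cutHalfPlane hTM (le_max_right _ _)
    refine AnalyticOnNhd.eqOn_of_preconnected_of_eventuallyEq
      ((hFd i j).analyticOnNhd (isOpen_cutHalfPlane a c M))
      ((hGd i j).analyticOnNhd (isOpen_cutHalfPlane a c M))
      (isPreconnected_cutHalfPlane a c M) (hsubT hz0) ?_ hz
    filter_upwards [(isOpen_halfPlane T).mem_nhds hz0] with w hw
    obtain ⟨h1, h2⟩ := heq w (hTM'.trans_lt hw)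
    rw [hGeq w h1, h2]
  rw [hGeq z hu] at hmain
  exact smul_right_injective _ ((Matrix.isUnit_iff_isUnit_det _).mp hu).ne_zero hmain

/-- The Darboux matrix at zero maps the initial Weyl solution to the columns `[I; φ]`. -/
theorem darbouxMat_mul_weyl (ha : a ≠ 0) {z : ℂ} (hA : IsUnit (A - z • 1))
    (hu : IsUnit (pencil a c ζ A S0 L1 L2 z)) :
    darbouxMat A (Matrix.fromCols L1 L2) S0 z *
      (Matrix.fromRows (1 : Matrix (Fin p) (Fin p) ℂ)
        ((hFun c ζ z / (Complex.I * a)) • (1 : Matrix (Fin p) (Fin p) ℂ)) *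
        (1 + C1Mat a S0 L1 * (pencil a c ζ A S0 L1 L2 z)⁻¹ * BMat a (hFun c ζ z) L1 L2)) =
      Matrix.fromRows 1 (weylFormula a c ζ A S0 L1 L2 z) := by
  have hdet := (Matrix.isUnit_iff_isUnit_det _).mp hA
  have hpen := Matrix.mul_nonsing_inv _ ((Matrix.isUnit_iff_isUnit_det _).mp hu)
  have hA' := Matrix.nonsing_inv_mul _ hdet
  rw [weylFormula]
  set R := (pencil a c ζ A S0 L1 L2 z)⁻¹ with hR
  set h := hFun c ζ z with hh
  set B := BMat a h L1 L2 with hB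
  have hIa : Complex.I * a ≠ 0 := mul_ne_zero Complex.I_ne_zero ha
  -- State-space inversion: the upper block of the transformed initial value is `I - C₁ (A - z)⁻¹
  -- B`, whose inverse is `I + C₁ R B` because `A - z` is the pencil plus `B C₁`.
  have h1 : B * (1 + C1Mat a S0 L1 * R * B) = (A - z • 1) * (R * B) := by
    have : (A - z • 1) = pencil a c ζ A S0 L1 L2 z + B * C1Mat a S0 L1 := by
      rw [pencil, ACross]; abel
    rw [this, Matrix.add_mul, ← Matrix.mul_assoc _ R B, hpen, Matrix.mul_add, Matrix.one_mul,
      Matrix.mul_one]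
    simp only [Matrix.mul_assoc]
  have h2 : Matrix.fromCols L1 L2 * (Matrix.fromRows (1 : Matrix (Fin p) (Fin p) ℂ)
      ((h / (Complex.I * a)) • (1 : Matrix (Fin p) (Fin p) ℂ))) = (1 / (Complex.I * a)) • B := by
    rw [Matrix.fromCols_mul_fromRows, Matrix.mul_one, Matrix.mul_smul, Matrix.mul_one, hB, BMat,
      smul_add, smul_smul, smul_smul, one_div, inv_mul_cancel₀ hIa, one_smul, div_eq_inv_mul]
  have h3 : (A - z • 1)⁻¹ * (Matrix.fromCols L1 L2 *
      (Matrix.fromRows (1 : Matrix (Fin p) (Fin p) ℂ)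
      ((h / (Complex.I * a)) • (1 : Matrix (Fin p) (Fin p) ℂ)) *
      (1 + C1Mat a S0 L1 * R * B))) = (1 / (Complex.I * a)) • (R * B) := by
    rw [← Matrix.mul_assoc (Matrix.fromCols L1 L2), h2, Matrix.smul_mul, h1, Matrix.mul_smul,
      ← Matrix.mul_assoc, hA', Matrix.one_mul]
  rw [darbouxMat, Matrix.sub_mul, Matrix.one_mul, Matrix.smul_mul, Matrix.mul_assoc _ _
    (Matrix.fromRows _ _ * _), Matrix.mul_assoc _ (A - z • 1)⁻¹, h3, Matrix.mul_smul,
    Matrix.conjTranspose_fromCols_eq_fromRows_conjTranspose, Matrix.fromRows_mul,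
    Matrix.fromRows_mul, Matrix.fromRows_mul, smul_smul, DMat, C1Mat, C2Mat]
  have hk : Complex.I * (1 / (Complex.I * a)) = 1 / a := by field_simp
  rw [hk]
  ext (i | i) j
  · simp only [Matrix.sub_apply, Matrix.smul_apply, Matrix.fromRows_apply_inl, Matrix.one_mul,
      Matrix.smul_mul, Matrix.add_apply, Matrix.mul_assoc]
    ring
  · simp only [Matrix.sub_apply, Matrix.smul_apply, Matrix.fromRows_apply_inr, Matrix.one_mul,
      Matrix.smul_mul, Matrix.add_apply, Matrix.mul_assoc, Matrix.sub_mul, Matrix.mul_add,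
      smul_eq_mul]
    field_simp
    ring

end Formula

theorem norm_fromRows_le {m k l : Type*} [Fintype m] [Fintype k] [Fintype l]
    (F : Matrix m k ℂ) (G : Matrix l k ℂ) : ‖Matrix.fromRows F G‖ ≤ ‖F‖ + ‖G‖ := by
  refine le_of_sq_le_sq ?_ (by positivity)
  rw [norm_fromRows_sq]
  nlinarith [norm_nonneg F, norm_nonneg G]

/-! ### Estimates high up in the half-plane. -/

section Bounds

variable {a : ℂ} {c : ℝ} {ζ : ℂ → ℂ}

theorem norm_BMat_le (hζ : IsUpperBranch a c ζ) (L1 L2 : Matrix (Fin n) (Fin p) ℂ) {z : ℂ}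
    (hz : z ∈ halfPlane ‖a‖) : ‖BMat a (hFun c ζ z) L1 L2‖ ≤ ‖a‖ * ‖L1‖ + ‖a‖ * ‖L2‖ := by
  refine (norm_add_le _ _).trans ?_
  rw [norm_smul, norm_smul, norm_mul, Complex.norm_I, one_mul]
  gcongr
  exact hζ.norm_hFun_le hz

/-- High up in the half-plane the pencil and `A - z I` are invertible, with uniform bounds. -/
theorem exists_halfPlane_bound (hζ : IsUpperBranch a c ζ) (A S0 : Matrix (Fin n) (Fin n) ℂ)
    (L1 L2 : Matrix (Fin n) (Fin p) ℂ) (τ : ℝ) : ∃ M C : ℝ, ‖a‖ ≤ M ∧ 0 < M ∧ 0 ≤ C ∧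
      ∀ z ∈ halfPlane M, IsUnit (A - z • 1) ∧ IsUnit (pencil a c ζ A S0 L1 L2 z) ∧ τ ≤ z.im ∧
        ‖1 + C1Mat a S0 L1 * (pencil a c ζ A S0 L1 L2 z)⁻¹ * BMat a (hFun c ζ z) L1 L2‖ ≤ C := by
  set β := ‖a‖ * ‖L1‖ + ‖a‖ * ‖L2‖ with hβ
  set κ := ‖A‖ + β * ‖C1Mat a S0 L1‖ with hκ
  set e := ‖(1 : Matrix (Fin n) (Fin n) ℂ)‖ with he
  have hβ0 : 0 ≤ β := by positivity
  have hκ0 : 0 ≤ κ := by positivity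
  have he0 : 0 ≤ e := norm_nonneg _
  have hAκ : ‖A‖ ≤ κ := le_add_of_nonneg_right (by positivity)
  -- Since `|h| ≤ |a|` there, `κ` bounds `A` and `A^×` uniformly in `z`. The product `(κ + 1)(e +
  -- 1)` dominates both `κ e`, needed for invertibility, and `κ + 1`, needed for the resolvent
  -- bound.
  refine ⟨‖a‖ + |τ| + (κ + 1) * (e + 1),
    ‖(1 : Matrix (Fin p) (Fin p) ℂ)‖ + ‖C1Mat a S0 L1‖ * e * β, ?_, by positivity, by positivity,
    fun z hz => ?_⟩
  · have : 0 ≤ |τ| + (κ + 1) * (e + 1) := by positivity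
    linarith
  · have hz' : ‖a‖ + |τ| + (κ + 1) * (e + 1) < z.im := hz
    have h0 := abs_nonneg τ
    have hna := norm_nonneg a
    have h1 : 0 ≤ κ * e := by positivity
    have hza : z ∈ halfPlane ‖a‖ := by
      change ‖a‖ < z.im
      nlinarith
    have hzn : z.im ≤ ‖z‖ := Complex.im_le_norm z
    have hB := norm_BMat_le hζ L1 L2 hza
    have hK : ‖ACross a (hFun c ζ z) A S0 L1 L2‖ ≤ κ := by
      refine (norm_sub_le _ _).trans (add_le_add_right ?_ _)
      exact (Matrix.frobenius_norm_mul _ _).trans (by gcongr)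
    have hunit : IsUnit (pencil a c ζ A S0 L1 L2 z) :=
      isUnit_sub_smul_one (lt_of_le_of_lt (mul_le_mul_of_nonneg_right hK he0) (by nlinarith))
    refine ⟨isUnit_sub_smul_one (lt_of_le_of_lt (mul_le_mul_of_nonneg_right hAκ he0)
      (by nlinarith)), hunit, ?_, ?_⟩
    · nlinarith [le_abs_self τ]
    · have hR : ‖(pencil a c ζ A S0 L1 L2 z)⁻¹‖ ≤ e :=
        norm_inv_sub_smul_one_le hunit (by nlinarith)
      refine (norm_add_le _ _).trans (add_le_add_right ?_ _)
      refine (Matrix.frobenius_norm_mul _ _).trans ?_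
      gcongr
      exact (Matrix.frobenius_norm_mul _ _).trans (by gcongr)

theorem smul_fromRows {m k l : Type*} (t : ℂ) (F : Matrix m k ℂ) (G : Matrix l k ℂ) :
    t • Matrix.fromRows F G = Matrix.fromRows (t • F) (t • G) := by
  ext (i | i) j <;> rfl

/-- The decaying solution of the initial system. -/
theorem initialSol_mul_weyl (ha : a ≠ 0) (hζ : IsUpperBranch a c ζ) {z : ℂ}
    (hz : z ∈ cutHalfPlane a c 0) (x : ℝ) :
    initialSol p a c z (ζ z) x * Matrix.fromRows (1 : Matrix (Fin p) (Fin p) ℂ)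
        ((hFun c ζ z / (Complex.I * a)) • (1 : Matrix (Fin p) (Fin p) ℂ)) =
      Complex.exp (Complex.I * ζ z * x) • Matrix.fromRows
        (Complex.exp (Complex.I * c * x) • (1 : Matrix (Fin p) (Fin p) ℂ))
        ((Complex.exp (-(Complex.I * c * x)) * (hFun c ζ z / (Complex.I * a))) •
          (1 : Matrix (Fin p) (Fin p) ℂ)) := by
  have hζ0 := hζ.ne_zero hz
  have hmul := hζ.hFun_mul hz
  have hh : hFun c ζ z = z - c - ζ z := rfl
  have hn : (‖a‖ : ℂ) ^ 2 = star a * a := (Complex.conj_mul' a).symm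
  rw [hn] at hmul
  have hexp : Complex.exp (Complex.I * ζ z * x) =
      Complex.cos (ζ z * x) + ζ z * (Complex.sin (ζ z * x) / ζ z) * Complex.I := by
    rw [mul_div_cancel₀ _ hζ0, ← Complex.exp_mul_I]; congr 1; ring
  rw [hexp, initialSol]
  generalize Complex.sin (ζ z * x) / ζ z = σ
  rw [Matrix.fromBlocks_mul_fromRows]
  generalize star a = b at *
  have hI := Complex.I_sq
  simp only [Matrix.mul_one, Matrix.mul_smul, smul_smul, ← add_smul, smul_fromRows]
  have hIa : Complex.I * a ≠ 0 := mul_ne_zero Complex.I_ne_zero ha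
  congr 2
  · rw [hh]; field_simp
    linear_combination (σ * (z - c - ζ z)) * hI
  · have ha2 : hFun c ζ z / (Complex.I * a) * (Complex.I * a) = hFun c ζ z :=
      div_mul_cancel₀ _ hIa
    generalize hFun c ζ z / (Complex.I * a) = φ at *
    have hb : -b = Complex.I * φ * (z - c + ζ z) := by
      refine mul_right_cancel₀ ha ?_
      linear_combination -hmul - (z - c + ζ z) * ha2
    linear_combination (Complex.exp (-(Complex.I * c * x)) * σ) * hb

/-- The factors `e^{±icx}` are unimodular and `|h/(ia)| ≤ 1`, so only `e^{iζx}` affects the size. -/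
theorem norm_initialSol_mul_weyl_le (ha : a ≠ 0) (hζ : IsUpperBranch a c ζ) {z : ℂ}
    (hz : z ∈ halfPlane ‖a‖) (x : ℝ) :
    ‖initialSol p a c z (ζ z) x * Matrix.fromRows (1 : Matrix (Fin p) (Fin p) ℂ)
        ((hFun c ζ z / (Complex.I * a)) • (1 : Matrix (Fin p) (Fin p) ℂ))‖ ≤
      Real.exp (-((ζ z).im * x)) * (2 * ‖(1 : Matrix (Fin p) (Fin p) ℂ)‖) := by
  rw [initialSol_mul_weyl ha hζ (halfPlane_subset_cutHalfPlane (norm_nonneg a) le_rfl hz),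
    norm_smul, Complex.norm_exp]
  have e1 : (Complex.I * ζ z * x).re = -((ζ z).im * x) := by simp
  have e2 : ‖Complex.exp (Complex.I * c * x)‖ = 1 := by simp [Complex.norm_exp]
  have e3 : ‖Complex.exp (-(Complex.I * c * x))‖ = 1 := by simp [Complex.norm_exp]
  have e4 : ‖hFun c ζ z / (Complex.I * a)‖ ≤ 1 := by
    rw [norm_div, norm_mul, Complex.norm_I, one_mul]
    exact div_le_one_of_le₀ (hζ.norm_hFun_le hz) (norm_nonneg _)
  rw [e1]
  gcongr
  refine (norm_fromRows_le _ _).trans ?_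
  rw [norm_smul, norm_smul, e2, norm_mul, e3, two_mul, one_mul, one_mul]
  gcongr
  exact mul_le_of_le_one_left (norm_nonneg _) e4

end Bounds

/-! ### Existence: the formula is a Weyl function and a GW-function. -/

namespace IsDarbouxData

variable {a : ℂ} {c : ℝ} {ζ : ℂ → ℂ} {A S0 : Matrix (Fin n) (Fin n) ℂ}
  {L1 L2 : Matrix (Fin n) (Fin p) ℂ}
  {P : ℝ → Matrix (Fin n) (Fin p ⊕ Fin p) ℂ} {S : ℝ → Matrix (Fin n) (Fin n) ℂ}

theorem norm_darbouxPotential_entry_le (h : IsDarbouxData A (initialPotential p a c) P S) {x : ℝ}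
    (hx : 0 ≤ x) (i k : Fin p) :
    ‖darbouxPotential (initialPotential p a c x) (P x) (S x) i k‖ ≤
      ‖a‖ + 4 * A.trace.im := by
  have h1 : ‖initialPotential p a c x i k‖ ≤ ‖a‖ := by
    have e : ‖Complex.exp (2 * Complex.I * c * x)‖ = 1 := by simp [Complex.norm_exp]
    rw [initialPotential, Matrix.smul_apply, smul_eq_mul, norm_mul, norm_mul, e, mul_one]
    refine mul_le_of_le_one_right (norm_nonneg _) ?_
    rw [Matrix.one_apply]; split_ifs <;> simp
  have h2 : ‖(gramMat (P x) (S x)).toBlocks₁₂ i k‖ ≤ 2 * A.trace.im :=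
    (norm_entry_le _ (Sum.inl i) (Sum.inr k)).trans (h.norm_gramMat_le hx)
  refine (norm_add_le _ _).trans (add_le_add h1 ?_)
  rw [Matrix.smul_apply, norm_smul, RCLike.norm_ofNat]
  linarith

/-- The normalised fundamental solution of the transformed system. -/
theorem isNormalizedFundamentalSolution (h : IsDarbouxData A (initialPotential p a c) P S)
    (hζ : IsUpperBranch a c ζ) {U : Set ℂ} (hU : U ⊆ cutHalfPlane a c 0)
    (hA : ∀ z ∈ U, IsUnit (A - z • 1)) :
    IsNormalizedFundamentalSolution
      (fun x => darbouxPotential (initialPotential p a c x) (P x) (S x)) U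
      (fun x z => darbouxMat A (P x) (S x) z *
        (initialSol p a c z (ζ z) x * (darbouxMat A (P 0) (S 0) z)⁻¹)) := by
  intro z hz
  have hz0 := hU hz
  refine ⟨?_, fun x hx => ?_⟩
  · simp only [initialSol_zero, Matrix.one_mul]
    exact Matrix.mul_nonsing_inv _ ((Matrix.isUnit_iff_isUnit_det _).mp
      (h.isUnit_darbouxMat (hA z hz) hz0.1.le le_rfl))
  · refine h.deriv_darbouxMat_mul (hA z hz) hx (U := fun t => initialSol p a c z (ζ z) t *
      (darbouxMat A (P 0) (S 0) z)⁻¹) ?_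
    refine ((hasMatDeriv_initialSol (hζ.ne_zero hz0) (hζ z hz0.1 hz0.2).1 _ x).mul
      (HasMatDeriv.const _)).congr_deriv ?_
    rw [Matrix.mul_zero, add_zero, Matrix.mul_assoc]

end IsDarbouxData

theorem IsNormalizedFundamentalSolution.hasMatDeriv_weylSolution
    {v : ℝ → Matrix (Fin p) (Fin p) ℂ} {U : Set ℂ}
    {W : ℝ → ℂ → Matrix (Fin p ⊕ Fin p) (Fin p ⊕ Fin p) ℂ}
    (hW : IsNormalizedFundamentalSolution v U W) (φ : ℂ → Matrix (Fin p) (Fin p) ℂ) {z : ℂ}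
    (hz : z ∈ U) {x : ℝ} (hx : 0 ≤ x) :
    HasMatDeriv (fun t => weylSolution W φ t z) (systemMat (v x) z * weylSolution W φ x z)
      (Set.Ici 0) x := by
  have h1 : HasMatDeriv (fun t => W t z) (systemMat (v x) z * W x z) (Set.Ici 0) x :=
    (hW z hz).2 x hx
  refine (h1.mul (HasMatDeriv.const _)).congr_deriv ?_
  rw [weylSolution, Matrix.mul_zero, add_zero, Matrix.mul_assoc]

theorem IsNormalizedFundamentalSolution.weylSolution_zero
    {v : ℝ → Matrix (Fin p) (Fin p) ℂ} {U : Set ℂ}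
    {W : ℝ → ℂ → Matrix (Fin p ⊕ Fin p) (Fin p ⊕ Fin p) ℂ}
    (hW : IsNormalizedFundamentalSolution v U W) (φ : ℂ → Matrix (Fin p) (Fin p) ℂ) {z : ℂ}
    (hz : z ∈ U) : weylSolution W φ 0 z = Matrix.fromRows 1 (φ z) := by
  rw [weylSolution, (hW z hz).1, Matrix.one_mul]

/-- An exponential bound for the Weyl solutions gives the Weyl property. -/
theorem IsNormalizedFundamentalSolution.integrableOn
    {v : ℝ → Matrix (Fin p) (Fin p) ℂ} {U : Set ℂ}
    {W : ℝ → ℂ → Matrix (Fin p ⊕ Fin p) (Fin p ⊕ Fin p) ℂ}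
    (hW : IsNormalizedFundamentalSolution v U W) {φ : ℂ → Matrix (Fin p) (Fin p) ℂ} {z : ℂ}
    (hz : z ∈ U) {C δ : ℝ} (hδ : 0 < δ)
    (hb : ∀ x, 0 ≤ x → ‖weylSolution W φ x z‖ ≤ C * Real.exp (-(δ * x))) (i k : Fin p) :
    IntegrableOn (fun x : ℝ => ((weylSolution W φ x z)ᴴ * weylSolution W φ x z) i k)
      (Set.Ioi 0) := by
  have hint : IntegrableOn (fun x : ℝ => C ^ 2 * Real.exp (-(2 * δ) * x)) (Set.Ioi 0) :=
    (integrableOn_exp_mul_Ioi (by linarith) 0).const_mul _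
  refine Integrable.mono' hint ?_ ?_
  · refine ContinuousOn.aestronglyMeasurable (fun x hx => ?_) measurableSet_Ioi
    have hd := hW.hasMatDeriv_weylSolution φ hz (le_of_lt hx)
    exact ((hd.conjTranspose.mul hd) i k).continuousWithinAt.mono Set.Ioi_subset_Ici_self
  · refine (ae_restrict_iff' measurableSet_Ioi).mpr (Filter.Eventually.of_forall fun x hx => ?_)
    have h0 := hb x (le_of_lt hx)
    refine (norm_entry_le _ i k).trans ((Matrix.frobenius_norm_mul _ _).trans ?_)
    rw [Matrix.frobenius_norm_conjTranspose]
    calc ‖weylSolution W φ x z‖ * ‖weylSolution W φ x z‖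
        ≤ (C * Real.exp (-(δ * x))) * (C * Real.exp (-(δ * x))) :=
          mul_self_le_mul_self (norm_nonneg _) h0
      _ = C ^ 2 * Real.exp (-(2 * δ) * x) := by
          rw [show -(2 * δ) * x = -(δ * x) + -(δ * x) by ring, Real.exp_add]; ring

namespace IsDarbouxData

variable {a : ℂ} {c : ℝ} {ζ : ℂ → ℂ} {A S0 : Matrix (Fin n) (Fin n) ℂ}
  {L1 L2 : Matrix (Fin n) (Fin p) ℂ}
  {P : ℝ → Matrix (Fin n) (Fin p ⊕ Fin p) ℂ} {S : ℝ → Matrix (Fin n) (Fin n) ℂ}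

theorem exists_isWeylFunction_weylFormula (h : IsDarbouxData A (initialPotential p a c) P S)
    (ha : a ≠ 0) (hζ : IsUpperBranch a c ζ) (hP : P 0 = Matrix.fromCols L1 L2) (hS : S 0 = S0) :
    ∃ M : ℝ, ‖a‖ ≤ M ∧ (∀ z ∈ halfPlane M, IsUnit (pencil a c ζ A S0 L1 L2 z)) ∧
      IsWeylFunction (fun x => darbouxPotential (initialPotential p a c x) (P x) (S x)) M
        (weylFormula a c ζ A S0 L1 L2) ∧
      IsGWFunction (fun x => darbouxPotential (initialPotential p a c x) (P x) (S x)) M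
        (weylFormula a c ζ A S0 L1 L2) := by
  -- The level `2 Im tr A` is the threshold above which the Darboux matrix has norm bound `3`.
  obtain ⟨M, C, hM, hM0, hC, hb⟩ := exists_halfPlane_bound hζ A S0 L1 L2 (2 * A.trace.im)
  have hU : halfPlane M ⊆ cutHalfPlane a c 0 := halfPlane_subset_cutHalfPlane hM0.le hM
  have hW := h.isNormalizedFundamentalSolution hζ hU fun z hz => (hb z hz).1
  have hhol : HolomorphicOn (weylFormula a c ζ A S0 L1 L2) (halfPlane M) :=
    matDifferentiableOn_weylFormula hζ hU fun z hz => (hb z hz).2.1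
  set W : ℝ → ℂ → Matrix (Fin p ⊕ Fin p) (Fin p ⊕ Fin p) ℂ :=
    fun x z => darbouxMat A (P x) (S x) z *
        (initialSol p a c z (ζ z) x * (darbouxMat A (P 0) (S 0) z)⁻¹) with hWdef
  set C' := 3 * (2 * ‖(1 : Matrix (Fin p) (Fin p) ℂ)‖ * C) with hC'
  have hC'0 : 0 ≤ C' := by positivity
  have hest : ∀ z ∈ halfPlane M, ∀ x, 0 ≤ x →
      ‖weylSolution W (weylFormula a c ζ A S0 L1 L2) x z‖ ≤
        C' * Real.exp (-((ζ z).im * x)) := by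
    intro z hz x hx
    obtain ⟨h1, h2, h3, h4⟩ := hb z hz
    have hza : z ∈ halfPlane ‖a‖ := hM.trans_lt hz
    have h5 := darbouxMat_mul_weyl (S0 := S0) ha h1 h2
    rw [← hP, ← hS] at h5
    have hdet := (Matrix.isUnit_iff_isUnit_det _).mp
      (h.isUnit_darbouxMat h1 (hU hz).1.le le_rfl)
    rw [weylSolution, hWdef]
    simp only
    -- Writing `[I; φ]` as the image of `w(0, z)` cancels the normalising factor `w(0, z)⁻¹`,
    -- leaving `w(x, z)` applied to the decaying initial solution times the bounded factor `1 + C₁ R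
    -- B`.
    rw [← hS, ← h5, Matrix.mul_assoc, Matrix.mul_assoc,
      ← Matrix.mul_assoc (darbouxMat A (P 0) (S 0) z)⁻¹, Matrix.nonsing_inv_mul _ hdet,
      Matrix.one_mul]
    refine (h.norm_darbouxMat_mul_le h1 h3 hx _).trans ?_
    rw [← Matrix.mul_assoc]
    have h6 := norm_initialSol_mul_weyl_le (p := p) ha hζ hza x
    rw [← hS] at h4
    calc 3 * ‖_‖ ≤ 3 * (‖_‖ * ‖_‖) := by
          gcongr
          exact Matrix.frobenius_norm_mul _ _
      _ ≤ 3 * ((Real.exp (-((ζ z).im * x)) * (2 * ‖(1 : Matrix (Fin p) (Fin p) ℂ)‖)) * C) := by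
          gcongr
      _ = C' * Real.exp (-((ζ z).im * x)) := by rw [hC']; ring
  refine ⟨M, hM, fun z hz => (hb z hz).2.1, ⟨hM0, hhol, W, hW, fun z hz i k => ?_⟩,
    hM0, fun l => ⟨‖a‖ + 4 * A.trace.im, fun x hx i k =>
      h.norm_darbouxPotential_entry_le hx.1 i k⟩, hhol, W, hW, fun l => ?_⟩
  · exact hW.integrableOn hz (hζ z (hU hz).1 (hU hz).2).2 (hest z hz) i k
  · refine ⟨C' * Real.exp (‖a‖ * l), fun x hx z hz i k => ?_⟩
    have hza : z ∈ halfPlane ‖a‖ := hM.trans_lt hz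
    refine (norm_entry_le _ i k).trans ?_
    rw [norm_smul, Complex.norm_exp]
    have e1 : (-(Complex.I * z * x)).re = z.im * x := by simp
    -- The difference is `Im h`. This makes the exponential weight harmless on `[0, l]`, uniformly
    -- in `z`.
    have e2 : z.im - (ζ z).im ≤ ‖a‖ := by
      have := (Complex.im_le_norm (hFun c ζ z)).trans (hζ.norm_hFun_le hza)
      simpa [hFun] using this
    rw [e1]
    calc Real.exp (z.im * x) * ‖_‖
        ≤ Real.exp (z.im * x) * (C' * Real.exp (-((ζ z).im * x))) := by
          gcongr
          exact hest z hz x hx.1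
      _ = C' * Real.exp ((z.im - (ζ z).im) * x) := by
          rw [sub_mul, sub_eq_add_neg, Real.exp_add]; ring
      _ ≤ C' * Real.exp (‖a‖ * l) := by
          gcongr
          · exact hx.1
          · exact hx.2

end IsDarbouxData

/-! ### Uniqueness of Weyl and GW-functions for bounded potentials. -/

theorem two_mul_re_trace_le {m k : Type*} [Fintype m] [Fintype k] (F G : Matrix m k ℂ) :
    2 * (Fᴴ * G).trace.re ≤ ‖F‖ ^ 2 + ‖G‖ ^ 2 := by
  have h1 := congrArg Complex.re (trace_conjTranspose_mul_self (F - G))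
  have h2 : (Gᴴ * F).trace.re = (Fᴴ * G).trace.re := by
    have : Gᴴ * F = (Fᴴ * G)ᴴ := by
      rw [Matrix.conjTranspose_mul, Matrix.conjTranspose_conjTranspose]
    rw [this, Matrix.trace_conjTranspose]; simp
  rw [Matrix.conjTranspose_sub, Matrix.sub_mul, Matrix.mul_sub, Matrix.mul_sub,
    Matrix.trace_sub, Matrix.trace_sub, Matrix.trace_sub, trace_conjTranspose_mul_self,
    trace_conjTranspose_mul_self] at h1
  simp only [Complex.sub_re, Complex.ofReal_re, h2] at h1
  nlinarith [sq_nonneg ‖F - G‖]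

theorem HasMatDeriv.re_trace {m : Type*} [Fintype m] {F : ℝ → Matrix m m ℂ} {F' : Matrix m m ℂ}
    {s : Set ℝ} {x : ℝ} (hF : HasMatDeriv F F' s x) :
    HasDerivWithinAt (fun t => (F t).trace.re) F'.trace.re s x :=
  Complex.reCLM.hasFDerivAt.comp_hasDerivWithinAt x
    (HasDerivWithinAt.fun_sum fun i _ => hF i i)

theorem re_trace_jMat_fromRows {k : Type*} [Fintype k] (F G : Matrix (Fin p) k ℂ) :
    ((Matrix.fromRows F G)ᴴ * jMat p * Matrix.fromRows F G).trace.re = ‖F‖ ^ 2 - ‖G‖ ^ 2 := by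
  rw [jMat, Matrix.conjTranspose_fromRows_eq_fromCols_conjTranspose,
    Matrix.fromCols_mul_fromBlocks, Matrix.fromCols_mul_fromRows]
  simp [trace_conjTranspose_mul_self, -Complex.ofReal_pow, sub_eq_add_neg]

/-- This is the matrix of the derivative of `Y* j Y` along solutions; for large `Im z` the negative
multiple of the identity outweighs the bounded potential. -/
theorem systemMat_energy (v : Matrix (Fin p) (Fin p) ℂ) (z : ℂ) :
    (systemMat v z)ᴴ * jMat p + jMat p * systemMat v z =
      (-(2 * z.im : ℂ)) • 1 + (2 : ℂ) • potential v := by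
  have hz : star (Complex.I * z) + Complex.I * z = -(2 * z.im : ℂ) := by
    apply Complex.ext <;> simp; ring
  rw [systemMat, Matrix.conjTranspose_add, Matrix.conjTranspose_smul, Matrix.conjTranspose_mul,
    jMat_conjTranspose, potential_conjTranspose, Matrix.add_mul, Matrix.mul_add, Matrix.mul_assoc,
    Matrix.smul_mul, Matrix.mul_smul, ← Matrix.mul_assoc (jMat p) (jMat p), jMat_mul_self, ← hz]
  simp only [Matrix.mul_one, Matrix.one_mul]
  module

/-- Solutions starting in the lower component do not decay, if `Im z` is large. -/
theorem norm_le_norm_of_hasMatDeriv {v : ℝ → Matrix (Fin p) (Fin p) ℂ} {κ : ℝ}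
    (hκ : ∀ x, 0 ≤ x → ‖potential (v x)‖ ≤ κ) {z : ℂ} (hz : 1 + κ ^ 2 ≤ 2 * z.im)
    {k : Type*} [Fintype k] {Y : ℝ → Matrix (Fin p ⊕ Fin p) k ℂ}
    (hY : ∀ x, 0 ≤ x → HasMatDeriv Y (systemMat (v x) z * Y x) (Set.Ici 0) x)
    {ξ : Matrix (Fin p) k ℂ} (h0 : Y 0 = Matrix.fromRows 0 ξ) {x : ℝ} (hx : 0 ≤ x) :
    ‖ξ‖ ≤ ‖Y x‖ := by
  have hd : ∀ t, 0 ≤ t → HasDerivWithinAt (fun t => ((Y t)ᴴ * jMat p * Y t).trace.re)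
      ((Y t)ᴴ * ((-(2 * z.im : ℂ)) • Y t + (2 : ℂ) • (potential (v t) * Y t))).trace.re
      (Set.Ici 0) t := by
    intro t ht
    refine ((((hY t ht).conjTranspose.mul (HasMatDeriv.const (jMat p))).mul
      (hY t ht)).congr_deriv ?_).re_trace
    have : (-(2 * z.im : ℂ)) • Y t + (2 : ℂ) • (potential (v t) * Y t) =
        ((systemMat (v t) z)ᴴ * jMat p + jMat p * systemMat (v t) z) * Y t := by
      rw [systemMat_energy]
      simp only [Matrix.add_mul, Matrix.smul_mul, Matrix.one_mul]
    rw [this]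
    simp only [Matrix.conjTranspose_mul, Matrix.mul_zero, add_zero, Matrix.add_mul, Matrix.mul_add,
      Matrix.mul_assoc]
  -- The potential contributes at most `(1 + κ²) ‖Y‖²`, by `2 Re tr(F* G) ≤ ‖F‖² + ‖G‖²`; this is
  -- the source of the threshold on `Im z`.
  have hle : ∀ t, 0 ≤ t →
      ((Y t)ᴴ * ((-(2 * z.im : ℂ)) • Y t + (2 : ℂ) • (potential (v t) * Y t))).trace.re ≤ 0 := by
    intro t ht
    have h1 := two_mul_re_trace_le (Y t) (potential (v t) * Y t)
    have h2 : ‖potential (v t) * Y t‖ ≤ κ * ‖Y t‖ :=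
      (Matrix.frobenius_norm_mul _ _).trans (by gcongr; exact hκ t ht)
    have h3 : ‖potential (v t) * Y t‖ ^ 2 ≤ (κ * ‖Y t‖) ^ 2 :=
      pow_le_pow_left₀ (norm_nonneg _) h2 2
    have h4 : ((Y t)ᴴ * ((-(2 * z.im : ℂ)) • Y t +
        (2 : ℂ) • (potential (v t) * Y t))).trace.re =
        -(2 * z.im) * ‖Y t‖ ^ 2 + 2 * ((Y t)ᴴ * (potential (v t) * Y t)).trace.re := by
      rw [Matrix.mul_add, Matrix.mul_smul, Matrix.mul_smul, Matrix.trace_add, Matrix.trace_smul,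
        Matrix.trace_smul, trace_conjTranspose_mul_self, smul_eq_mul, smul_eq_mul]
      simp [-Complex.ofReal_pow]
    rw [h4]
    have h5 := mul_le_mul_of_nonneg_right hz (sq_nonneg ‖Y t‖)
    nlinarith
  have hanti : AntitoneOn (fun t => ((Y t)ᴴ * jMat p * Y t).trace.re) (Set.Ici 0) :=
    antitoneOn_of_hasDerivWithinAt_nonpos (convex_Ici 0)
      (fun t ht => (hd t ht).continuousWithinAt)
      (fun t ht => (hd t (interior_subset ht)).mono interior_subset)
      (fun t ht => hle t (interior_subset ht))
  have h1 := hanti (Set.mem_Ici.mpr le_rfl) hx hx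
  simp only [h0, re_trace_jMat_fromRows] at h1
  obtain ⟨F, G, hFG⟩ : ∃ F G, Y x = Matrix.fromRows F G :=
    ⟨_, _, (Matrix.fromRows_toRows (Y x)).symm⟩
  rw [hFG, re_trace_jMat_fromRows] at h1
  refine le_of_sq_le_sq ?_ (norm_nonneg _)
  rw [hFG, norm_fromRows_sq]
  rw [norm_zero] at h1
  nlinarith [sq_nonneg ‖F‖]

section Uniqueness

variable {v : ℝ → Matrix (Fin p) (Fin p) ℂ} {κ : ℝ} {M₁ M₂ : ℝ}
  {ψ₁ ψ₂ : ℂ → Matrix (Fin p) (Fin p) ℂ}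

/-- Both solutions start with upper block `I`, so their difference starts in the lower component and
cannot decay. -/
theorem norm_sub_le_norm_weylSolution_sub (hκ : ∀ x, 0 ≤ x → ‖potential (v x)‖ ≤ κ)
    {W₁ W₂ : ℝ → ℂ → Matrix (Fin p ⊕ Fin p) (Fin p ⊕ Fin p) ℂ} {U₁ U₂ : Set ℂ}
    (hW₁ : IsNormalizedFundamentalSolution v U₁ W₁)
    (hW₂ : IsNormalizedFundamentalSolution v U₂ W₂) {z : ℂ} (hz₁ : z ∈ U₁) (hz₂ : z ∈ U₂)
    (hz : 1 + κ ^ 2 ≤ 2 * z.im) {x : ℝ} (hx : 0 ≤ x) :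
    ‖ψ₁ z - ψ₂ z‖ ≤ ‖weylSolution W₁ ψ₁ x z - weylSolution W₂ ψ₂ x z‖ := by
  refine norm_le_norm_of_hasMatDeriv hκ hz
    (Y := fun t => weylSolution W₁ ψ₁ t z - weylSolution W₂ ψ₂ t z) (fun t ht => ?_) ?_ hx
  · rw [Matrix.mul_sub]
    exact (hW₁.hasMatDeriv_weylSolution ψ₁ hz₁ ht).sub (hW₂.hasMatDeriv_weylSolution ψ₂ hz₂ ht)
  · simp only [hW₁.weylSolution_zero ψ₁ hz₁, hW₂.weylSolution_zero ψ₂ hz₂]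
    ext (i | i) j <;> simp

theorem integrableOn_norm_sq_weylSolution
    {W : ℝ → ℂ → Matrix (Fin p ⊕ Fin p) (Fin p ⊕ Fin p) ℂ}
    {ψ : ℂ → Matrix (Fin p) (Fin p) ℂ} {z : ℂ}
    (h : ∀ i k, IntegrableOn
        (fun x : ℝ => ((weylSolution W ψ x z)ᴴ * weylSolution W ψ x z) i k) (Set.Ioi 0)) :
    IntegrableOn (fun x => ‖weylSolution W ψ x z‖ ^ 2) (Set.Ioi 0) := by
  have h1 : IntegrableOn
      (fun x => ((weylSolution W ψ x z)ᴴ * weylSolution W ψ x z).trace) (Set.Ioi 0) :=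
    integrable_finsetSum _ fun i _ => h i i
  simp only [trace_conjTranspose_mul_self] at h1
  exact h1.re

/-- Weyl functions are unique high up in the half-plane. -/
theorem IsWeylFunction.eq_of_im_large (hκ : ∀ x, 0 ≤ x → ‖potential (v x)‖ ≤ κ)
    (h₁ : IsWeylFunction v M₁ ψ₁) (h₂ : IsWeylFunction v M₂ ψ₂) {z : ℂ} (hz₁ : z ∈ halfPlane M₁)
    (hz₂ : z ∈ halfPlane M₂) (hz : 1 + κ ^ 2 ≤ 2 * z.im) : ψ₁ z = ψ₂ z := by
  obtain ⟨-, -, W₁, hW₁, hi₁⟩ := h₁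
  obtain ⟨-, -, W₂, hW₂, hi₂⟩ := h₂
  have hint := ((integrableOn_norm_sq_weylSolution (hi₁ z hz₁)).add
    (integrableOn_norm_sq_weylSolution (hi₂ z hz₂))).const_mul 2
  have hconst : IntegrableOn (fun _ : ℝ => ‖ψ₁ z - ψ₂ z‖ ^ 2) (Set.Ioi 0) := by
    refine Integrable.mono' hint aestronglyMeasurable_const ?_
    refine (ae_restrict_iff' measurableSet_Ioi).mpr (Filter.Eventually.of_forall fun x hx => ?_)
    have h1 := norm_sub_le_norm_weylSolution_sub (ψ₁ := ψ₁) (ψ₂ := ψ₂) hκ hW₁ hW₂ hz₁ hz₂ hz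
      (le_of_lt hx)
    have h2 := norm_sub_le (weylSolution W₁ ψ₁ x z) (weylSolution W₂ ψ₂ x z)
    have h3 := pow_le_pow_left₀ (norm_nonneg _) (h1.trans h2) 2
    rw [norm_pow, norm_norm]
    refine h3.trans ?_
    simp only [Pi.add_apply]
    nlinarith [sq_nonneg (‖weylSolution W₁ ψ₁ x z‖ - ‖weylSolution W₂ ψ₂ x z‖)]
  -- A constant is integrable on a half-line of infinite measure only if it is zero.
  rw [integrableOn_const_iff] at hconst
  rcases hconst with h | h
  · exact sub_eq_zero.mp (norm_eq_zero.mp (pow_eq_zero_iff two_ne_zero |>.mp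
      (enorm_eq_zero.mp h)))
  · simp at h

/-- A holomorphic function in a half-plane which decays faster than any exponential vanishes. -/
theorem eq_zero_of_exp_decay {f : ℂ → ℂ} {M : ℝ} (hf : DifferentiableOn ℂ f (halfPlane M))
    (hdec : ∀ l : ℝ, 0 ≤ l → ∃ K : ℝ, ∀ z ∈ halfPlane M, ‖f z‖ ≤ K * Real.exp (-(l * z.im)))
    {z : ℂ} (hz : z ∈ halfPlane (M + 1)) : f z = 0 := by
  -- Rotation to the right half-plane; the shift by `M + 1` keeps the closed half-plane inside the
  -- open domain of `f`.
  set g : ℂ → ℂ := fun w => f (Complex.I * (w + (M + 1 : ℝ))) with hg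
  have him : ∀ w : ℂ, (Complex.I * (w + (M + 1 : ℝ))).im = w.re + (M + 1) := by
    intro w; simp
  have hmem : ∀ w : ℂ, 0 ≤ w.re → Complex.I * (w + (M + 1 : ℝ)) ∈ halfPlane M := by
    intro w hw
    change M < _
    rw [him]; linarith
  obtain ⟨K₀, hK₀⟩ := hdec 0 le_rfl
  have hb : ∀ w : ℂ, 0 ≤ w.re → ‖g w‖ ≤ K₀ := fun w hw => by
    simpa [hg] using hK₀ _ (hmem w hw)
  have hzero := PhragmenLindelof.eq_zero_on_right_half_plane_of_superexponential_decay
    (f := g) ?_ ⟨1, one_lt_two, 0, ?_⟩ ?_ ⟨K₀, fun x => hb _ (by simp)⟩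
  · have hw : 0 ≤ (-Complex.I * z - (M + 1 : ℝ)).re := by
      have : M + 1 < z.im := hz
      simp; linarith
    have h1 := hzero hw
    simp only [hg, sub_add_cancel, Pi.zero_apply] at h1
    rwa [← mul_assoc, mul_neg, Complex.I_mul_I, neg_neg, one_mul] at h1
  · refine DifferentiableOn.diffContOnCl ?_
    rw [Complex.closure_setOfPred_lt_re]
    refine hf.comp (by fun_prop) fun w hw => hmem w hw
  · refine Asymptotics.IsBigO.of_bound K₀ ?_
    filter_upwards [Filter.mem_inf_of_right (Filter.mem_principal_self _)] with w hw
    simpa using hb w (le_of_lt hw)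
  · intro m
    -- One exponent more than `m`, so that a factor `e^{-x}` survives multiplication by `e^{mx}`.
    obtain ⟨K, hK⟩ := hdec (m + 1) (by positivity)
    have hlim : Filter.Tendsto (fun x : ℝ =>
        K * Real.exp (-((m + 1) * (M + 1))) * Real.exp (-x)) Filter.atTop (nhds 0) := by
      simpa using Real.tendsto_exp_neg_atTop_nhds_zero.const_mul
        (K * Real.exp (-((m + 1) * (M + 1))))
    refine squeeze_zero' (Filter.Eventually.of_forall fun x => by positivity) ?_ hlim
    filter_upwards [Filter.eventually_ge_atTop 0] with x hx
    have h1 := hK _ (hmem x (by simpa using hx))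
    rw [him, Complex.ofReal_re] at h1
    calc Real.exp x ^ m * ‖g x‖
        ≤ Real.exp x ^ m * (K * Real.exp (-((m + 1) * (x + (M + 1))))) := by gcongr
      _ = K * (Real.exp (m * x) * Real.exp (-((m + 1) * (x + (M + 1))))) := by
          rw [Real.exp_nat_mul]; ring
      _ = K * Real.exp (-((m + 1) * (M + 1))) * Real.exp (-x) := by
          rw [← Real.exp_add, mul_assoc, ← Real.exp_add]; congr 2; ring

/-- Generalised Weyl functions are unique high up in the half-plane. -/
theorem IsGWFunction.eq_of_im_large (hκ : ∀ x, 0 ≤ x → ‖potential (v x)‖ ≤ κ)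
    (h₁ : IsGWFunction v M₁ ψ₁) (h₂ : IsGWFunction v M₂ ψ₂) {z : ℂ}
    (hz : z ∈ halfPlane (max (max M₁ M₂) (1 + κ ^ 2) + 1)) : ψ₁ z = ψ₂ z := by
  obtain ⟨-, -, hh₁, W₁, hW₁, hb₁⟩ := h₁
  obtain ⟨hM₂, -, hh₂, W₂, hW₂, hb₂⟩ := h₂
  obtain ⟨C, hC, hnorm⟩ := exists_norm_le_of_entries (Fin p ⊕ Fin p) (Fin p)
  set M := max (max M₁ M₂) (1 + κ ^ 2) with hM
  have hs₁ : halfPlane M ⊆ halfPlane M₁ :=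
    fun w hw => ((le_max_left M₁ M₂).trans (le_max_left _ _)).trans_lt hw
  have hs₂ : halfPlane M ⊆ halfPlane M₂ :=
    fun w hw => ((le_max_right M₁ M₂).trans (le_max_left _ _)).trans_lt hw
  ext i k
  refine sub_eq_zero.mp (eq_zero_of_exp_decay (f := fun w => ψ₁ w i k - ψ₂ w i k)
    (((hh₁ i k).mono hs₁).sub ((hh₂ i k).mono hs₂)) (fun l hl => ?_) hz)
  obtain ⟨K₁, hK₁⟩ := hb₁ l
  obtain ⟨K₂, hK₂⟩ := hb₂ l
  refine ⟨C * |K₁| + C * |K₂|, fun w hw => ?_⟩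
  have him : 1 + κ ^ 2 < w.im := (le_max_right _ _).trans_lt hw
  have h1 := norm_sub_le_norm_weylSolution_sub (ψ₁ := ψ₁) (ψ₂ := ψ₂) hκ hW₁ hW₂ (hs₁ hw) (hs₂ hw)
    (by nlinarith [sq_nonneg κ]) hl
  -- At the fixed point `x = l`, removing the weight from the GW bound yields decay `e^{-l Im z}`.
  -- As `l` is arbitrary, the decay beats every exponential.
  have hexp : ∀ Y : Matrix (Fin p ⊕ Fin p) (Fin p) ℂ,
      ‖Y‖ = ‖Complex.exp (-(Complex.I * w * l)) • Y‖ * Real.exp (-(l * w.im)) := by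
    intro Y
    have : (-(Complex.I * w * l)).re = w.im * l := by simp
    rw [norm_smul, Complex.norm_exp, this, mul_right_comm, ← Real.exp_add]
    ring_nf
    simp
  have hl' : l ∈ Set.Icc 0 l := ⟨hl, le_rfl⟩
  have e₁ := hnorm _ |K₁| (abs_nonneg _)
    fun i k => (hK₁ l hl' w (hs₁ hw) i k).trans (le_abs_self _)
  have e₂ := hnorm _ |K₂| (abs_nonneg _)
    fun i k => (hK₂ l hl' w (hs₂ hw) i k).trans (le_abs_self _)
  calc ‖ψ₁ w i k - ψ₂ w i k‖ ≤ ‖ψ₁ w - ψ₂ w‖ := norm_entry_le (ψ₁ w - ψ₂ w) i k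
    _ ≤ ‖weylSolution W₁ ψ₁ l w‖ + ‖weylSolution W₂ ψ₂ l w‖ := h1.trans (norm_sub_le _ _)
    _ ≤ C * |K₁| * Real.exp (-(l * w.im)) + C * |K₂| * Real.exp (-(l * w.im)) := by
        rw [hexp (weylSolution W₁ ψ₁ l w), hexp (weylSolution W₂ ψ₂ l w)]
        gcongr
    _ = (C * |K₁| + C * |K₂|) * Real.exp (-(l * w.im)) := by ring

end Uniqueness

theorem exists_norm_potential_le {v : ℝ → Matrix (Fin p) (Fin p) ℂ} {K : ℝ}
    (hK : ∀ x, 0 ≤ x → ∀ i k, ‖v x i k‖ ≤ K) : ∃ κ, ∀ x, 0 ≤ x → ‖potential (v x)‖ ≤ κ := by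
  obtain ⟨C, hC, hnorm⟩ := exists_norm_le_of_entries (Fin p ⊕ Fin p) (Fin p ⊕ Fin p)
  refine ⟨C * |K|, fun x hx => hnorm _ _ (abs_nonneg K) ?_⟩
  rintro (i | i) (j | j)
  · simp [potential]
  · simpa [potential] using (hK x hx i j).trans (le_abs_self K)
  · simpa [potential] using (hK x hx j i).trans (le_abs_self K)
  · simp [potential]

end SkewDirac

end

/-! ### Assembly of the theorem. -/

theorem mainTheorem3 {n p : ℕ} (a : ℂ) (ha : a ≠ 0) (c : ℝ)
    (A Q S0 : Matrix (Fin n) (Fin n) ℂ) (f1 f2 : Matrix (Fin n) (Fin p) ℂ)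
    (hdet : ((A - (c : ℂ) • 1) ^ 2 + ((‖a‖ : ℂ) ^ 2) • 1).det ≠ 0)
    (hcomm : A * Q = Q * A)
    (hQ : Q ^ 2 = (A - (c : ℂ) • 1) ^ 2 + ((‖a‖ : ℂ) ^ 2) • 1)
    (hS0 : S0.PosDef)
    (hid : A * S0 - S0 * Aᴴ = Complex.I •
      (SkewDirac.PiMat a c A Q f1 f2 0 * (SkewDirac.PiMat a c A Q f1 f2 0)ᴴ))
    (ζ : ℂ → ℂ) (hζ : SkewDirac.IsUpperBranch a c ζ)
    -- the transformed potential, and the values at zero of the two blocks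
    (v : ℝ → Matrix (Fin p) (Fin p) ℂ)
    (hv : v = SkewDirac.transformedPotential a c A Q S0 f1 f2)
    (L1 L2 : Matrix (Fin n) (Fin p) ℂ)
    (hL1 : L1 = SkewDirac.Lam1 c Q f1 f2 0) (hL2 : L2 = SkewDirac.Lam2 a c A Q f1 f2 0) :
    -- the formula gives a Weyl function and a GW-function
    (∃ M : ℝ, ‖a‖ ≤ M ∧
      (∀ z ∈ SkewDirac.halfPlane M, IsUnit (SkewDirac.pencil a c ζ A S0 L1 L2 z)) ∧
      SkewDirac.IsWeylFunction v M (SkewDirac.weylFormula a c ζ A S0 L1 L2) ∧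
      SkewDirac.IsGWFunction v M (SkewDirac.weylFormula a c ζ A S0 L1 L2)) ∧
    -- every Weyl function and every GW-function is given by the formula
    (∀ (M : ℝ) (ψ : ℂ → Matrix (Fin p) (Fin p) ℂ),
      SkewDirac.IsWeylFunction v M ψ ∨ SkewDirac.IsGWFunction v M ψ →
      ∀ z ∈ SkewDirac.halfPlane M, ¬ (z.re = c ∧ z.im ≤ ‖a‖) →
        IsUnit (SkewDirac.pencil a c ζ A S0 L1 L2 z) →
        ψ z = SkewDirac.weylFormula a c ζ A S0 L1 L2 z) := by
  have h := SkewDirac.isDarbouxData_initial ha hcomm hQ hS0 hid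
  have hv' : v = fun x => SkewDirac.darbouxPotential (SkewDirac.initialPotential p a c x)
      (SkewDirac.PiMat a c A Q f1 f2 x) (SkewDirac.SMat a c A Q S0 f1 f2 x) := by
    rw [hv]; funext x; exact SkewDirac.transformedPotential_eq x
  have hS : SkewDirac.SMat a c A Q S0 f1 f2 0 = S0 := by ext i j; simp [SkewDirac.SMat]
  have hP : SkewDirac.PiMat a c A Q f1 f2 0 = Matrix.fromCols L1 L2 := by
    rw [hL1, hL2]; rfl
  obtain ⟨M₁, hM₁, hu, hweyl, hgw⟩ := h.exists_isWeylFunction_weylFormula ha hζ hP hS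
  rw [← hv'] at hweyl hgw
  refine ⟨⟨M₁, hM₁, hu, hweyl, hgw⟩, fun M ψ hψ z hz hcut hpen => ?_⟩
  obtain ⟨κ, hκ⟩ := SkewDirac.exists_norm_potential_le (v := v)
    (fun x hx i k => by rw [hv']; exact h.norm_darbouxPotential_entry_le hx i k)
  have hψ' : 0 < M ∧ SkewDirac.HolomorphicOn ψ (SkewDirac.halfPlane M) := by
    rcases hψ with hψ | hψ
    · exact ⟨hψ.1, hψ.2.1⟩
    · exact ⟨hψ.1, hψ.2.2.1⟩
  -- The level lies above both half-planes of definition and above the energy threshold; the extra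
  -- `1` is the shift used in the Phragmén–Lindelöf step. Above it, `ψ` is compared with the
  -- formula, already known to be a function of the same kind.
  refine SkewDirac.eq_weylFormula_of_eqOn hζ (M' := max (max M M₁) (1 + κ ^ 2) + 1) hψ'.1 hψ'.2
    (fun w hw => ?_) ⟨hz, hcut⟩ hpen
  have hw' : max (max M M₁) (1 + κ ^ 2) + 1 < w.im := hw
  have h1 : M < w.im := by
    linarith [(le_max_left M M₁).trans (le_max_left (max M M₁) (1 + κ ^ 2))]
  have h2 : M₁ < w.im := by
    linarith [(le_max_right M M₁).trans (le_max_left (max M M₁) (1 + κ ^ 2))]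
  have h3 : 1 + κ ^ 2 < w.im := by linarith [le_max_right (max M M₁) (1 + κ ^ 2)]
  refine ⟨hu w h2, ?_⟩
  rcases hψ with hψ | hψ
  · exact hψ.eq_of_im_large hκ hweyl h1 h2 (by nlinarith [sq_nonneg κ])
  · exact hψ.eq_of_im_large hκ hgw hw
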